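/- **Notation.** For $z,a\in\mathbb C$ and $n\in\mathbb N_0$ put $\langle z\rangle_{n,a}=z(z+a)\cdots(z+(n-1)a)$, $\langle z\rangle_{0,a}=1$, and $[z]_n=\langle z\rangle_{n,-1}$. For $\alpha,\beta,r\in\mathbb C$ the generalized Stirling numbers $S(n,k,\alpha,\beta,r)$ are the coefficients in $$\langle z\rangle_{n,-\alpha}=\sum_{k=0}^n S(n,k,\alpha,\beta,r)\,\langle z-r\rangle_{k,-\beta}$$ (and $0$ for $k>n$). For $\beta\ne0$ and $\varepsilon\in\mathbb R$ the generalized Stirling functions are $$S(n,\eta,\alpha,\beta,r;\varepsilon)=\frac1{\beta^\eta\,\Gamma(\eta+1)}\sum_{j\ge0}(-1)^j\binom{\eta}{j}e^{(\eta-j)\varepsilon}\,\langle r+(\eta-j)\beta\rangle_{n,-\alpha};$$ below $\eta$ is a non-negative integer, so the sum is finite. For a sequence $(a_i)_{i\ge1}$ and $j\ge0$ let $$W(n,j)=\sum\frac{a_1^{k_1}a_2^{k_2}\cdots a_n^{k_n}}{k_1!\,k_2!\cdots k_n!},$$ the sum being over the partitions $1^{k_1}2^{k_2}\cdots n^{k_n}$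 of $n$ into exactly $n-j$ parts. **Statement.** Let $\alpha,\beta,r\in\mathbb C$ with $\beta\ne0$. All limits are taken as the integer $\mu\to\infty$; $n$ denotes a non-negative integer that is either fixed or a function $n=n(\mu)$, and $m\ge0$ is a fixed integer. (1) *Case $\varepsilon\neq0$ ($\varepsilon$ real).* For all $\rho\in\mathbb C$ and $j\ge0$, $$\frac{S(j,1,\alpha,\beta,\rho;\varepsilon)}{j!}=\frac1{j!\,\beta}\left[e^{\varepsilon}\langle \rho+\beta\rangle_{j,-\alpha}-\langle \rho\rangle_{j,-\alpha}\right].$$ Let $a_j$ be this quantity at $\rho=r/\mu$ (so $a_0=(e^\varepsilon-1)/\beta$), let $W(n,j)$ be formed with these $a_j$, and let $$R_m(n,\mu)=\frac{\mu!\,S(n,\mu,\alpha,\beta,r;\varepsilon)}{[\mu]_n\,n!}-\left(\frac{\beta}{e^\varepsilon-1}\right)^{n-\mu}\sum_{j=0}^m\left(\frac{e^\varepsilon-1}{\beta}\right)^j\frac{W(n,j)}{[\mu-n+j]_j}.$$ If $n\to\infty$ and $n=o(\mu^{1/2})$, then $$R_m(n,\mu)=o\left(\left(\frac{\beta}{e^\varepsilon-1}\right)^{n-\mu}\frac{W(n,m)}{[\mu-n+m]_m}\right);$$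 if $n$ is fixed, then $R_m(n,\mu)=O\left(\left(\frac{\beta}{e^\varepsilon-1}\right)^{n-\mu}\mu^{-m-1}\right)$. (2) *Case $\varepsilon=0$.* For all $\rho\in\mathbb C$ and $j\ge0$, $$\frac{S(j+1,1,\alpha,\beta,\rho)}{(j+1)!}=\frac1{(j+1)!\,\beta}\left[\langle \rho+\beta\rangle_{j+1,-\alpha}-\langle \rho\rangle_{j+1,-\alpha}\right].$$ Let $a_j$ be this quantity at $\rho=r/\mu$, let $W(n,j)$ be formed with these $a_j$, and let $$\bar R_m(n,\mu)=\frac{S(n+\mu,\mu,\alpha,\beta,r)}{[\mu]_n\,[n+\mu]_n}-\sum_{j=0}^m\frac{W(n,j)}{[\mu-n+j]_j}.$$ If $n\to\infty$ and $n=o(\mu^{1/2})$, and if moreover $r=0$, or $\beta\ne\alpha$ and not both $m=1$ and $\beta=2\alpha$, then $$\bar R_m(n,\mu)=o\left(\frac{W(n,m)}{[\mu-n+m]_m}\right);$$ if $n$ is fixed, then $\bar R_m(n,\mu)=O(\mu^{-m-1})$ (for all $\alpha,\beta,r$ with $\beta\neq0$). -/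

import Mathlib

open Filter Asymptotics

/-- The generalized factorial `⟨z⟩_{n,a} = z (z + a) ⋯ (z + (n - 1) a)` of `z` with increment `a`. -/
def genFactorial (z : ℂ) (n : ℕ) (a : ℂ) : ℂ :=
  ∏ i ∈ Finset.range n, (z + i * a)

/-- The falling factorial `[x]_n = x (x - 1) ⋯ (x - n + 1) = ⟨x⟩_{n,-1}`. -/
def fallingFactorial (x : ℂ) (n : ℕ) : ℂ := genFactorial x n (-1)

/-- `c` is the coefficient sequence of the Newton expansion
`⟨z⟩_{n,-α} = ∑_{k=0}^n c_k ⟨z - r⟩_{k,-β}` (as an identity in `z`); `c_k = 0` for `k > n`. -/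
def IsNewtonExpansion (α β r : ℂ) (n : ℕ) (c : ℕ → ℂ) : Prop :=
  (∀ k, n < k → c k = 0) ∧
    ∀ z : ℂ, genFactorial z n (-α) =
      ∑ k ∈ Finset.range (n + 1), c k * genFactorial (z - r) k (-β)

theorem genFactorial_succ (z : ℂ) (n : ℕ) (a : ℂ) :
    genFactorial z (n + 1) a = genFactorial z n a * (z + n * a) := by
  simp [genFactorial, Finset.prod_range_succ]

theorem genFactorial_succ' (z : ℂ) (n : ℕ) (a : ℂ) :
    genFactorial z (n + 1) a = z * genFactorial (z + a) n a := by
  simp only [genFactorial, Finset.prod_range_succ']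
  rw [mul_comm]
  congr 1
  · simp
  · refine Finset.prod_congr rfl fun i _ => ?_
    push_cast
    ring

theorem exists_isNewtonExpansion (α β r : ℂ) (n : ℕ) :
    ∃ c : ℕ → ℂ, IsNewtonExpansion α β r n c := by
  induction n with
  | zero =>
    refine ⟨fun k => if k = 0 then 1 else 0, fun k hk => by simp; omega, fun z => ?_⟩
    simp [genFactorial]
  | succ n ih =>
    obtain ⟨c, hc0, hc⟩ := ih
    refine ⟨fun k => (r + k * β - n * α) * c k + (if k = 0 then 0 else c (k - 1)),
      fun k hk => ?_, fun z => ?_⟩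
    · have h1 := hc0 k (by omega)
      have h2 := hc0 (k - 1) (by omega)
      simp [h1, h2]
    · rw [genFactorial_succ, hc z]
      simp only [add_mul, Finset.sum_add_distrib]
      rw [Finset.sum_range_succ _ (n + 1), hc0 (n + 1) (by omega),
        Finset.sum_range_succ' _ (n + 1)]
      simp only [Nat.add_sub_cancel, Nat.succ_ne_zero, if_false, if_true, mul_zero, zero_mul,
        add_zero]
      rw [← Finset.sum_add_distrib, Finset.sum_mul]
      refine Finset.sum_congr rfl fun k _ => ?_
      rw [genFactorial_succ]
      ring

theorem newton_coeff_eq_zero (β : ℂ) (n : ℕ) : ∀ d : ℕ → ℂ,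
    (∀ w : ℂ, ∑ k ∈ Finset.range (n + 1), d k * genFactorial w k (-β) = 0) →
      ∀ k ≤ n, d k = 0 := by
  induction n with
  | zero =>
    intro d hd k hk
    obtain rfl : k = 0 := by omega
    simpa [genFactorial] using hd 0
  | succ n ih =>
    intro d hd
    have h0 : d 0 = 0 := by
      have := hd 0
      rw [Finset.sum_range_succ'] at this
      simp only [genFactorial_succ', zero_mul, mul_zero, Finset.sum_const_zero, zero_add] at this
      simpa [genFactorial] using this
    have key : ∀ w : ℂ,
        ∑ k ∈ Finset.range (n + 1), d (k + 1) * genFactorial w k (-β) = 0 := by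
      have hcont : Continuous fun w : ℂ =>
          ∑ k ∈ Finset.range (n + 1), d (k + 1) * genFactorial w k (-β) := by
        unfold genFactorial
        fun_prop
      have hdense : Dense ({-β}ᶜ : Set ℂ) := dense_compl_singleton _
      have := hcont.ext_on hdense continuous_const (g := fun _ => 0) (fun w hw => ?_)
      · exact fun w => congrFun this w
      · have hw' : w + β ≠ 0 := fun h => hw (by simpa using eq_neg_of_add_eq_zero_left h)
        have h1 := hd (w + β)
        rw [Finset.sum_range_succ', h0, zero_mul, add_zero] at h1
        have h2 : (w + β) *
            ∑ k ∈ Finset.range (n + 1), d (k + 1) * genFactorial w k (-β) = 0 := by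
          rw [← h1, Finset.mul_sum]
          refine Finset.sum_congr rfl fun k _ => ?_
          rw [genFactorial_succ', add_neg_cancel_right]
          ring
        exact (mul_eq_zero.mp h2).resolve_left hw'
    intro k hk
    rcases k with _ | k
    · exact h0
    · exact ih (fun k => d (k + 1)) key k (by omega)

theorem existsUnique_isNewtonExpansion (α β r : ℂ) (n : ℕ) :
    ∃! c : ℕ → ℂ, IsNewtonExpansion α β r n c := by
  obtain ⟨c, hc⟩ := exists_isNewtonExpansion α β r n
  refine ⟨c, hc, fun c' hc' => funext fun k => ?_⟩
  by_cases hk : n < k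
  · rw [hc.1 k hk, hc'.1 k hk]
  · refine sub_eq_zero.mp (newton_coeff_eq_zero β n (fun k => c' k - c k) (fun w => ?_) k
      (by omega))
    have h1 := hc.2 (w + r)
    have h2 := hc'.2 (w + r)
    rw [add_sub_cancel_right] at h1 h2
    simp only [sub_mul, Finset.sum_sub_distrib]
    rw [← h1, ← h2, sub_self]

/-- The generalized Stirling number `S(n, k, α, β, r)`: the `k`-th coefficient in
`⟨z⟩_{n,-α} = ∑_{k=0}^n S(n, k, α, β, r) ⟨z - r⟩_{k,-β}`. -/
noncomputable def genStirling (n k : ℕ) (α β r : ℂ) : ℂ :=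
  (existsUnique_isNewtonExpansion α β r n).choose k

/-- The generalized fractional difference with an exponential factor,
`Δ_β^{η,ε} f (z) = ∑_{j ≥ 0} (-1)^j (η choose j) e^{(η - j) ε} f (z + (η - j) β)`. -/
noncomputable def fracDiff (η β : ℂ) (ε : ℝ) (f : ℂ → ℂ) (z : ℂ) : ℂ :=
  ∑' j : ℕ, (-1) ^ j * Ring.choose η j * Complex.exp ((η - j) * ε) * f (z + (η - j) * β)

/-- The generalized Stirling function
`S(n, η, α, β, r; ε) = (β^η Γ(η + 1))⁻¹ Δ_β^{η,ε} ⟨z⟩_{n,-α} |_{z = r}`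
of integral first argument `n`. -/
noncomputable def genStirlingFun (n : ℕ) (η α β r : ℂ) (ε : ℝ) : ℂ :=
  1 / (β ^ η * Complex.Gamma (η + 1)) * fracDiff η β ε (fun z => genFactorial z n (-α)) r

/-- `W(n, j) = ∑ a_1^{k_1} ⋯ a_n^{k_n} / (k_1! ⋯ k_n!)`, summed over the partitions
`1^{k_1} 2^{k_2} ⋯ n^{k_n}` of `n` with `n - j` parts (so `W(n, j) = 0` for `j ≥ n ≥ 1`). -/
noncomputable def partitionSum (a : ℕ → ℂ) (n j : ℕ) : ℂ :=
  ∑ p : n.Partition with p.parts.card + j = n,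
    ∏ i ∈ Finset.Icc 1 n, a i ^ p.parts.count i / ((p.parts.count i).factorial : ℂ)

/-- The coefficients `a_j = (e^ε ⟨ρ + β⟩_{j,-α} - ⟨ρ⟩_{j,-α}) / (j! β)` for `ε ≠ 0`;
here `a_0 = (e^ε - 1) / β`. -/
noncomputable def coeffEps (α β ρ : ℂ) (ε : ℝ) (j : ℕ) : ℂ :=
  1 / (j.factorial * β) *
    (Complex.exp ε * genFactorial (ρ + β) j (-α) - genFactorial ρ j (-α))

/-- The coefficients `a_j = (⟨ρ + β⟩_{j+1,-α} - ⟨ρ⟩_{j+1,-α}) / ((j + 1)! β)` for `ε = 0`. -/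
noncomputable def coeffZero (α β ρ : ℂ) (j : ℕ) : ℂ :=
  1 / ((j + 1).factorial * β) *
    (genFactorial (ρ + β) (j + 1) (-α) - genFactorial ρ (j + 1) (-α))

/-- The normalized Stirling function `μ! S(n, μ, α, β, r; ε) / ([μ]_n n!)`. -/
noncomputable def normStirlingEps (α β r : ℂ) (ε : ℝ) (n μ : ℕ) : ℂ :=
  μ.factorial * genStirlingFun n μ α β r ε / (fallingFactorial μ n * n.factorial)

/-- The normalized Stirling number `S(n + μ, μ, α, β, r) / ([μ]_n [n + μ]_n)`. -/
noncomputable def normStirlingZero (α β r : ℂ) (n μ : ℕ) : ℂ :=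
  genStirling (n + μ) μ α β r / (fallingFactorial μ n * fallingFactorial ((n : ℂ) + μ) n)

/-- The term `W(n, j) / [μ - n + j]_j`, with `W` built from the coefficients `a`. -/
noncomputable def expansionTerm (a : ℕ → ℂ) (n μ j : ℕ) : ℂ :=
  partitionSum a n j / fallingFactorial ((μ : ℂ) - n + j) j

/-- The leading factor `(β / (e^ε - 1))^{n - μ}`. -/
noncomputable def leadFactor (β : ℂ) (ε : ℝ) (n μ : ℕ) : ℂ :=
  (β / (Complex.exp ε - 1)) ^ ((n : ℤ) - (μ : ℤ))

/-- The remainder of the expansion of order `m` for `ε ≠ 0`, with `r / μ` in the coefficients. -/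
noncomputable def remainderEps (α β r : ℂ) (ε : ℝ) (m n μ : ℕ) : ℂ :=
  normStirlingEps α β r ε n μ -
    leadFactor β ε n μ * ∑ j ∈ Finset.range (m + 1),
      ((Complex.exp ε - 1) / β) ^ j * expansionTerm (coeffEps α β (r / μ) ε) n μ j

/-- The remainder of the expansion of order `m` for `ε = 0`, with `r / μ` in the coefficients. -/
noncomputable def remainderZero (α β r : ℂ) (m n μ : ℕ) : ℂ :=
  normStirlingZero α β r n μ -
    ∑ j ∈ Finset.range (m + 1), expansionTerm (coeffZero α β (r / μ)) n μ j

/-!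
Let `E_z(t) = ∑ ⟨z⟩_{n,-α} tⁿ / n!`, the expansion of `(1 + α t)^{z/α}`. It satisfies
`(1 + α t) E_z' = z E_z`, hence `E_{z+w} = E_z E_w`. Consequently, with `ρ = r / μ`, both kinds of
Stirling quantities are coefficients of a pure power: up to factorials they are the coefficients of
`((w E_{ρ+β} - E_ρ) / β)^μ`, with `w = e^ε` (`genStirlingFun_eq_coeff_pow`) or `w = 1`
(`genStirling_eq_coeff_pow`). For `w = 1` the base has no constant term, and a factor `t^μ` is
divided out. In both cases the normalized quantity is `[tⁿ] A^μ / [μ]_n`, where `A = ∑ a_j t^j` is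
the generating series of the coefficients in the statement.

By the multinomial theorem, `W(n, j) = [t^j] B^{n-j} / (n-j)!` with `B = ∑ a_{i+1} tⁱ`
(`partitionSum_eq_coeff_pow`). Expanding `A^μ = (a_0 + t B)^μ` shows that the expansion, carried to
`j = n`, is an exact identity (`coeff_pow_div_eq_sum_expansionTerm`), so the remainder is the sum of
the terms with `j > m`. For fixed `n` there are finitely many of them, each `O(μ^{-m-1})`.

For `n → ∞` the terms with `j > m` have to be compared with the term `j = m`. It suffices that
`[t^j] B^{n-j}` is at most of order `(C n)^{j-m}` relative to `[t^m] B^{n-m}` (`TailDominated`): the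
later terms are then bounded by a geometric series of ratio `O(n² / μ)`, which tends to zero
(`norm_sum_expansionTerm_le`). To obtain this domination, write `B = b_0 (1 + D)` and
`[t^j] (1 + D)^N = ∑_l (N choose l) [t^j] D^l`. If `d_1` has a nonzero limit, the summand `l = m`
dominates and `[t^m] (1 + D)^{n-m}` has order `n^m`. In the exceptional cases (`β = α` for `ε ≠ 0`,
`β = 2 α` for `ε = 0`) every coefficient of `D` is of size `O(ρ)`, so that `n D` is small and the
summand `l = 1` dominates; what is needed then is that `a_{m+1}` vanishes only to first order at
`ρ = 0`, which is where the exclusion of `m = 1` for `β = 2 α` comes from. When `r = 0` this is not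
needed, since then `D = 0`. If `ε = 0` and `β = α`, then `b_0 = a_1 = ρ` tends to zero; the case
`r = 0`, in which `B = 0`, is the only one covered.
-/

/-! ### The exponential generating function of the generalized factorials -/

/-- The series `∑ ⟨z⟩_{n,-α} tⁿ / n!`, that is, the expansion of `(1 + α t)^{z / α}`
(of `e^{z t}` when `α = 0`). -/
noncomputable def factorialSeries (α z : ℂ) : PowerSeries ℂ :=
  PowerSeries.mk fun n => genFactorial z n (-α) / (n.factorial : ℂ)

theorem coeff_factorialSeries (α z : ℂ) (n : ℕ) :
    PowerSeries.coeff n (factorialSeries α z) = genFactorial z n (-α) / (n.factorial : ℂ) :=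
  PowerSeries.coeff_mk _ _

theorem coeff_succ_factorialSeries (α z : ℂ) (n : ℕ) :
    PowerSeries.coeff (n + 1) (factorialSeries α z) * ((n : ℂ) + 1) =
      (z - n * α) * PowerSeries.coeff n (factorialSeries α z) := by
  have h1 : (n.factorial : ℂ) ≠ 0 := by exact_mod_cast n.factorial_ne_zero
  have h2 : (n : ℂ) + 1 ≠ 0 := by exact_mod_cast n.succ_ne_zero
  rw [coeff_factorialSeries, coeff_factorialSeries, genFactorial_succ, Nat.factorial_succ]
  push_cast
  field_simp
  ring

/-- The coefficients of a solution of `(1 + α t) f' = z f` satisfy a two-term recurrence. -/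
theorem differentialEquation_iff_coeff_recurrence (α z : ℂ) (f : PowerSeries ℂ) :
    (1 + PowerSeries.C α * PowerSeries.X) * PowerSeries.derivative ℂ f = PowerSeries.C z * f ↔
      ∀ n : ℕ, PowerSeries.coeff (n + 1) f * ((n : ℂ) + 1) =
        (z - n * α) * PowerSeries.coeff n f := by
  rw [PowerSeries.ext_iff]
  refine forall_congr' fun n => ?_
  rw [add_mul, one_mul, mul_assoc, map_add, PowerSeries.coeff_C_mul, PowerSeries.coeff_C_mul,
    PowerSeries.coeff_derivative]
  rcases n with _ | n
  · simp
  · rw [PowerSeries.coeff_succ_X_mul, PowerSeries.coeff_derivative]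
    push_cast
    constructor <;> intro h <;> linear_combination h

theorem factorialSeries_unique (α z : ℂ) (f : PowerSeries ℂ) (h0 : PowerSeries.coeff 0 f = 1)
    (h : (1 + PowerSeries.C α * PowerSeries.X) * PowerSeries.derivative ℂ f =
      PowerSeries.C z * f) : f = factorialSeries α z := by
  rw [differentialEquation_iff_coeff_recurrence] at h
  ext n
  induction n with
  | zero => rw [h0, coeff_factorialSeries]; simp [genFactorial]
  | succ n ih =>
    have h2 : (n : ℂ) + 1 ≠ 0 := by exact_mod_cast n.succ_ne_zero
    refine mul_right_cancel₀ h2 ?_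
    rw [h, coeff_succ_factorialSeries, ih]

/-- The Vandermonde identity: `z ↦ (1 + α t)^{z / α}` turns sums into products. -/
theorem factorialSeries_add (α z w : ℂ) :
    factorialSeries α (z + w) = factorialSeries α z * factorialSeries α w := by
  symm
  have key (x : ℂ) := (differentialEquation_iff_coeff_recurrence α x (factorialSeries α x)).2
    (coeff_succ_factorialSeries α x)
  apply factorialSeries_unique
  · rw [PowerSeries.coeff_zero_eq_constantCoeff_apply, map_mul,
      ← PowerSeries.coeff_zero_eq_constantCoeff_apply,
      ← PowerSeries.coeff_zero_eq_constantCoeff_apply]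
    simp [coeff_factorialSeries, genFactorial]
  · rw [Derivation.leibniz, map_add]
    simp only [smul_eq_mul]
    linear_combination factorialSeries α z * key w + factorialSeries α w * key z

theorem factorialSeries_zero (α : ℂ) : factorialSeries α 0 = 1 := by
  symm
  apply factorialSeries_unique
  · simp
  · simp

theorem factorialSeries_pow (α z : ℂ) (k : ℕ) :
    factorialSeries α z ^ k = factorialSeries α (k * z) := by
  induction k with
  | zero => simp [factorialSeries_zero]
  | succ k ih =>
    rw [pow_succ, ih, ← factorialSeries_add]
    congr 1
    push_cast
    ring

/-! ### Partition sums as coefficients of powers -/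

theorem coeff_pow_congr {f g : PowerSeries ℂ} {n : ℕ}
    (h : ∀ i ≤ n, PowerSeries.coeff i f = PowerSeries.coeff i g) (k : ℕ) :
    PowerSeries.coeff n (f ^ k) = PowerSeries.coeff n (g ^ k) := by
  classical
  rw [PowerSeries.coeff_pow, PowerSeries.coeff_pow]
  refine Finset.sum_congr rfl fun l hl => Finset.prod_congr rfl fun i hi => h _ ?_
  rw [Finset.mem_finsuppAntidiag] at hl
  rw [← hl.1]
  exact Finset.single_le_sum (f := fun i => l i) (fun _ _ => Nat.zero_le _) hi

theorem count_sum_replicate (s : Finset ℕ) (f : ℕ → ℕ) (j : ℕ) :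
    (∑ i ∈ s, Multiset.replicate (f i) i).count j = if j ∈ s then f j else 0 := by
  rw [Multiset.count_sum']
  simp only [Multiset.count_replicate, Finset.sum_ite_eq']

/-- The partitions of `n` into `k` parts correspond to the families of multiplicities. -/
theorem sum_partition_eq_sum_piAntidiag (n k : ℕ) (F : (ℕ → ℕ) → ℂ) :
    ∑ p : n.Partition with p.parts.card = k, F (fun i => p.parts.count i) =
      ∑ f ∈ (Finset.Icc 1 n).piAntidiag k with ∑ i ∈ Finset.Icc 1 n, i * f i = n, F f := by
  have hsub (p : n.Partition) : p.parts.toFinset ⊆ Finset.Icc 1 n := fun i hi => by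
    rw [Multiset.mem_toFinset] at hi
    rw [Finset.mem_Icc]
    exact ⟨p.parts_pos hi, p.le_of_mem_parts hi⟩
  refine Finset.sum_bij' (fun p _ => fun i => p.parts.count i)
    (fun f hf => ⟨∑ i ∈ Finset.Icc 1 n, Multiset.replicate (f i) i, fun {i} hi => ?_, ?_⟩)
    ?_ ?_ ?_ ?_ ?_
  · obtain ⟨j, hj, hij⟩ := Multiset.mem_sum.1 hi
    rw [Multiset.eq_of_mem_replicate hij]
    exact (Finset.mem_Icc.1 hj).1
  · rw [Multiset.sum_sum]
    simp only [Multiset.sum_replicate, smul_eq_mul]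
    rw [Finset.mem_filter] at hf
    exact (Finset.sum_congr rfl fun i _ => mul_comm _ _).trans hf.2
  · intro p hp
    rw [Finset.mem_filter] at hp
    rw [Finset.mem_filter, Finset.mem_piAntidiag]
    refine ⟨⟨?_, fun i hi => hsub p ?_⟩, ?_⟩
    · rw [← hp.2]
      exact Multiset.sum_count_eq_card fun i hi => hsub p (Multiset.mem_toFinset.2 hi)
    · rw [Multiset.mem_toFinset]
      exact Multiset.count_ne_zero.1 hi
    · conv_rhs => rw [← p.parts_sum, Finset.sum_multiset_count_of_subset _ _ (hsub p)]
      exact Finset.sum_congr rfl fun i _ => by rw [smul_eq_mul, mul_comm]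
  · intro f hf
    rw [Finset.mem_filter, Finset.mem_piAntidiag] at hf
    simp only [Finset.mem_filter, Finset.mem_univ, true_and]
    rw [Multiset.card_sum]
    simpa using hf.1.1
  · intro p hp
    ext j
    simp only [count_sum_replicate]
    split_ifs with h
    · rfl
    · symm
      rw [Multiset.count_eq_zero]
      exact fun hj => h (hsub p (Multiset.mem_toFinset.2 hj))
  · intro f hf
    rw [Finset.mem_filter, Finset.mem_piAntidiag] at hf
    funext j
    simp only [count_sum_replicate]
    split_ifs with h
    · rfl
    · by_contra hne
      exact h (hf.1.2 j (Ne.symm hne))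
  · intro p hp
    rfl

/-- The multinomial theorem, read off at `tⁿ`: the sum over the partitions of `n` into `k` parts
is the coefficient of `(∑_{i ≥ 1} a_i tⁱ)ᵏ / k!`. -/
theorem sum_partition_eq_coeff_pow (a : ℕ → ℂ) (n k : ℕ) :
    ∑ p : n.Partition with p.parts.card = k,
        ∏ i ∈ Finset.Icc 1 n, a i ^ p.parts.count i / ((p.parts.count i).factorial : ℂ) =
      PowerSeries.coeff n ((PowerSeries.X * PowerSeries.mk fun i => a (i + 1)) ^ k) /
        (k.factorial : ℂ) := by
  have hk : (k.factorial : ℂ) ≠ 0 := by exact_mod_cast k.factorial_ne_zero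
  rw [sum_partition_eq_sum_piAntidiag n k
    (fun f => ∏ i ∈ Finset.Icc 1 n, a i ^ f i / ((f i).factorial : ℂ))]
  have htrunc : ∀ j ≤ n, PowerSeries.coeff j (PowerSeries.X * PowerSeries.mk fun i => a (i + 1)) =
      PowerSeries.coeff j
        (∑ i ∈ Finset.Icc 1 n, PowerSeries.C (a i) * (PowerSeries.X : PowerSeries ℂ) ^ i) := by
    intro j hj
    rw [map_sum]
    simp only [PowerSeries.coeff_C_mul, PowerSeries.coeff_X_pow, mul_ite, mul_one, mul_zero]
    rw [Finset.sum_ite_eq]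
    rcases j with _ | j
    · simp
    · rw [PowerSeries.coeff_succ_X_mul, PowerSeries.coeff_mk, if_pos]
      rw [Finset.mem_Icc]
      omega
  rw [coeff_pow_congr htrunc, Finset.sum_pow_eq_sum_piAntidiag, map_sum, Finset.sum_div,
    Finset.sum_filter]
  refine Finset.sum_congr rfl fun f hf => ?_
  rw [Finset.mem_piAntidiag] at hf
  have hmon : ∏ i ∈ Finset.Icc 1 n,
      (PowerSeries.C (a i) * (PowerSeries.X : PowerSeries ℂ) ^ i) ^ f i =
        PowerSeries.C (∏ i ∈ Finset.Icc 1 n, a i ^ f i) *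
        PowerSeries.X ^ (∑ i ∈ Finset.Icc 1 n, i * f i) := by
    simp only [mul_pow, Finset.prod_mul_distrib, map_prod, map_pow, ← pow_mul,
      Finset.prod_pow_eq_pow_sum]
  have hmult : (Nat.multinomial (Finset.Icc 1 n) f : ℂ) *
      ∏ i ∈ Finset.Icc 1 n, ((f i).factorial : ℂ) = k.factorial := by
    have := Nat.multinomial_spec (Finset.Icc 1 n) f
    rw [hf.1] at this
    rw [← this]
    push_cast
    ring
  have hprod : ∏ i ∈ Finset.Icc 1 n, ((f i).factorial : ℂ) ≠ 0 :=
    Finset.prod_ne_zero_iff.2 fun i _ => by exact_mod_cast (f i).factorial_ne_zero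
  have hcast : ((Nat.multinomial (Finset.Icc 1 n) f : ℕ) : PowerSeries ℂ) =
      PowerSeries.C (Nat.multinomial (Finset.Icc 1 n) f : ℂ) := by simp
  rw [hmon, hcast, PowerSeries.coeff_C_mul, PowerSeries.coeff_C_mul, PowerSeries.coeff_X_pow]
  by_cases h : ∑ i ∈ Finset.Icc 1 n, i * f i = n
  · rw [if_pos h, if_pos h.symm, Finset.prod_div_distrib, ← hmult]
    have hm : (Nat.multinomial (Finset.Icc 1 n) f : ℂ) ≠ 0 := by
      intro h0
      rw [h0, zero_mul] at hmult
      exact hk hmult.symm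
    field_simp
  · rw [if_neg h, if_neg (Ne.symm h)]
    simp

theorem partitionSum_eq_coeff_pow (a : ℕ → ℂ) {n j : ℕ} (hj : j ≤ n) :
    partitionSum a n j =
      PowerSeries.coeff j ((PowerSeries.mk fun i => a (i + 1)) ^ (n - j)) /
        ((n - j).factorial : ℂ) := by
  have h := sum_partition_eq_coeff_pow a n (n - j)
  rw [mul_pow, PowerSeries.coeff_X_pow_mul', if_pos (Nat.sub_le n j),
    Nat.sub_sub_self hj] at h
  rw [← h, partitionSum]
  refine Finset.sum_congr (Finset.filter_congr fun p _ => ?_) fun _ _ => rfl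
  omega

theorem partitionSum_eq_zero (a : ℕ → ℂ) {n j : ℕ} (hj : n < j) : partitionSum a n j = 0 := by
  rw [partitionSum, Finset.filter_false_of_mem, Finset.sum_empty]
  intro p _
  omega

/-! ### Stirling functions and numbers as coefficients of powers -/

theorem fallingFactorial_natCast (x n : ℕ) : fallingFactorial (x : ℂ) n = x.descFactorial n := by
  induction n with
  | zero => simp [fallingFactorial, genFactorial]
  | succ n ih =>
    rw [fallingFactorial] at ih ⊢
    rw [genFactorial_succ, ih, Nat.descFactorial_succ]
    rcases le_or_gt n x with h | h
    · push_cast [h]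
      ring
    · rw [Nat.descFactorial_of_lt h]
      simp

theorem genFactorial_mul (x a : ℂ) (n : ℕ) (b : ℂ) :
    genFactorial (x * b) n (a * b) = b ^ n * genFactorial x n a := by
  induction n with
  | zero => simp [genFactorial]
  | succ n ih => rw [genFactorial_succ, genFactorial_succ, ih]; ring

theorem genFactorial_natCast_mul (q n : ℕ) (β : ℂ) :
    genFactorial (q * β) n (-β) = β ^ n * n.factorial * q.choose n := by
  have h := genFactorial_mul q (-1) n β
  rw [neg_one_mul] at h
  have h2 := fallingFactorial_natCast q n
  rw [fallingFactorial] at h2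
  rw [h, h2, Nat.descFactorial_eq_factorial_mul_choose]
  push_cast
  ring

theorem genStirlingFun_natCast (n k : ℕ) (α β r : ℂ) (ε : ℝ) :
    genStirlingFun n k α β r ε = 1 / (β ^ k * k.factorial) *
      ∑ j ∈ Finset.range (k + 1), (-1) ^ j * (k.choose j : ℂ) * Complex.exp ε ^ (k - j) *
        genFactorial (r + ((k - j : ℕ) : ℂ) * β) n (-α) := by
  rw [genStirlingFun, Complex.cpow_natCast, Complex.Gamma_nat_eq_factorial, fracDiff]
  congr 1
  rw [tsum_eq_sum (s := Finset.range (k + 1))]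
  · refine Finset.sum_congr rfl fun j hj => ?_
    have hjk : j ≤ k := by rw [Finset.mem_range] at hj; omega
    rw [Ring.choose_natCast, ← Complex.exp_nat_mul]
    push_cast [hjk]
    rfl
  · intro j hj
    have hjk : k < j := by rw [Finset.mem_range] at hj; omega
    rw [Ring.choose_natCast, Nat.choose_eq_zero_of_lt hjk]
    simp

/-- The increments `(w E(ρ + β) - E(ρ)) / β` of the factorial series `E`, with a weight `w`. -/
noncomputable def differenceSeries (α β ρ w : ℂ) : PowerSeries ℂ :=
  PowerSeries.C (1 / β) *
    (PowerSeries.C w * factorialSeries α (ρ + β) - factorialSeries α ρ)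

theorem coeff_differenceSeries (α β ρ w : ℂ) (n : ℕ) :
    PowerSeries.coeff n (differenceSeries α β ρ w) = 1 / (n.factorial * β) *
      (w * genFactorial (ρ + β) n (-α) - genFactorial ρ n (-α)) := by
  rw [differenceSeries, PowerSeries.coeff_C_mul, map_sub, PowerSeries.coeff_C_mul,
    coeff_factorialSeries, coeff_factorialSeries]
  simp only [mul_inv_rev, div_eq_mul_inv]
  ring

theorem differenceSeries_pow (α β ρ w : ℂ) (k : ℕ) :
    differenceSeries α β ρ w ^ k = PowerSeries.C (1 / β ^ k) *
      ∑ j ∈ Finset.range (k + 1), PowerSeries.C ((-1) ^ j * (k.choose j : ℂ) * w ^ (k - j)) *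
        factorialSeries α (k * ρ + ((k - j : ℕ) : ℂ) * β) := by
  rw [differenceSeries, mul_pow, ← map_pow, one_div_pow, sub_eq_add_neg, add_comm, add_pow]
  congr 1
  refine Finset.sum_congr rfl fun j hj => ?_
  have hjk : j ≤ k := by rw [Finset.mem_range] at hj; omega
  have h : (k : ℂ) * ρ + ((k - j : ℕ) : ℂ) * β = j * ρ + ((k - j : ℕ) : ℂ) * (ρ + β) := by
    push_cast [hjk]
    ring
  rw [neg_pow, mul_pow, factorialSeries_pow, factorialSeries_pow, h, factorialSeries_add]
  simp only [map_mul, map_pow, map_neg, map_one, map_natCast]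
  ring

/-- Absorbing `r` into the base: with `ρ = r / μ` the Stirling function is a coefficient of a
pure `μ`-th power. -/
theorem genStirlingFun_eq_coeff_pow (n k : ℕ) (α β r ρ : ℂ) (ε : ℝ) (hρ : k * ρ = r) :
    k.factorial * genStirlingFun n k α β r ε =
      n.factorial * PowerSeries.coeff n (differenceSeries α β ρ (Complex.exp ε) ^ k) := by
  have hk : (k.factorial : ℂ) ≠ 0 := by exact_mod_cast k.factorial_ne_zero
  have hn : (n.factorial : ℂ) ≠ 0 := by exact_mod_cast n.factorial_ne_zero
  rw [genStirlingFun_natCast, differenceSeries_pow, PowerSeries.coeff_C_mul, map_sum, hρ]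
  simp only [PowerSeries.coeff_C_mul, coeff_factorialSeries]
  simp only [mul_div_assoc', ← Finset.sum_div]
  simp only [mul_comm _ β]
  field_simp

/-- Newton coefficients are determined by the values at the nodes `0, 1, 2, …`. -/
theorem eq_of_sum_choose_eq {x y : ℕ → ℂ}
    (h : ∀ q : ℕ, ∑ k ∈ Finset.range (q + 1), (q.choose k : ℂ) * x k =
      ∑ k ∈ Finset.range (q + 1), (q.choose k : ℂ) * y k) (k : ℕ) : x k = y k := by
  induction k using Nat.strong_induction_on with
  | _ k ih =>
    have hk := h k
    rw [Finset.sum_range_succ, Finset.sum_range_succ, Finset.sum_congr rfl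
      (fun i hi => by rw [ih i (Finset.mem_range.1 hi)])] at hk
    simpa using hk

theorem genStirling_spec (n : ℕ) (α β r : ℂ) :
    IsNewtonExpansion α β r n (fun k => genStirling n k α β r) :=
  (existsUnique_isNewtonExpansion α β r n).choose_spec.1

theorem genFactorial_eq_sum_genStirling (n q : ℕ) (α β r : ℂ) :
    genFactorial (r + q * β) n (-α) =
      ∑ k ∈ Finset.range (q + 1), (q.choose k : ℂ) * (β ^ k * k.factorial *
        genStirling n k α β r) := by
  have hspec := genStirling_spec n α β r
  rw [hspec.2, add_sub_cancel_left]
  -- Both ranges can be enlarged, the coefficients vanishing beyond `n` and `choose` beyond `q`.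
  rw [Finset.sum_subset (Finset.range_mono (show n + 1 ≤ n + q + 1 by omega)),
    Finset.sum_subset (Finset.range_mono (show q + 1 ≤ n + q + 1 by omega))]
  · refine Finset.sum_congr rfl fun k _ => ?_
    rw [genFactorial_natCast_mul]
    ring
  · intro k _ hk
    rw [Finset.mem_range] at hk
    rw [Nat.choose_eq_zero_of_lt (by omega)]
    simp
  · intro k _ hk
    rw [Finset.mem_range] at hk
    rw [hspec.1 k (by omega), zero_mul]

theorem genStirling_eq_coeff_pow (n k : ℕ) (α β r ρ : ℂ) (hβ : β ≠ 0) (hρ : k * ρ = r) :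
    k.factorial * genStirling n k α β r =
      n.factorial * PowerSeries.coeff n (differenceSeries α β ρ 1 ^ k) := by
  have hn : (n.factorial : ℂ) ≠ 0 := by exact_mod_cast n.factorial_ne_zero
  have hbase : PowerSeries.C (β ^ k) * differenceSeries α β ρ 1 ^ k =
      factorialSeries α r * (factorialSeries α β - 1) ^ k := by
    have h1 : PowerSeries.C β * differenceSeries α β ρ 1 =
        factorialSeries α ρ * (factorialSeries α β - 1) := by
      rw [differenceSeries, ← mul_assoc, ← map_mul, mul_one_div_cancel hβ, map_one,
        factorialSeries_add]
      ring
    rw [map_pow, ← mul_pow, h1, mul_pow, factorialSeries_pow, hρ]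
  have key := eq_of_sum_choose_eq
    (x := fun k => β ^ k * k.factorial * genStirling n k α β r)
    (y := fun k => n.factorial *
      PowerSeries.coeff n (factorialSeries α r * (factorialSeries α β - 1) ^ k)) ?_ k
  · simp only [← hbase, PowerSeries.coeff_C_mul] at key
    refine mul_left_cancel₀ (pow_ne_zero k hβ) ?_
    linear_combination key
  · intro q
    rw [← genFactorial_eq_sum_genStirling]
    have h1 : factorialSeries α (r + q * β) = ∑ k ∈ Finset.range (q + 1),
        PowerSeries.C (q.choose k : ℂ) *
          (factorialSeries α r * (factorialSeries α β - 1) ^ k) := by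
      rw [factorialSeries_add, ← factorialSeries_pow]
      conv_lhs => rw [← sub_add_cancel (factorialSeries α β) 1, add_pow, Finset.mul_sum]
      refine Finset.sum_congr rfl fun k _ => ?_
      rw [one_pow, map_natCast]
      ring
    have h2 := congrArg (PowerSeries.coeff n) h1
    rw [coeff_factorialSeries, map_sum, div_eq_iff hn] at h2
    rw [h2, Finset.sum_mul]
    refine Finset.sum_congr rfl fun k _ => ?_
    rw [PowerSeries.coeff_C_mul]
    ring

theorem coeffEps_eq_genStirlingFun (α β ρ : ℂ) (ε : ℝ) (j : ℕ) :
    coeffEps α β ρ ε j = genStirlingFun j 1 α β ρ ε / (j.factorial : ℂ) := by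
  have h := genStirlingFun_natCast j 1 α β ρ ε
  rw [Nat.cast_one] at h
  rw [coeffEps, h]
  simp [Finset.sum_range_succ]
  ring

theorem coeffZero_eq_genStirling (α β ρ : ℂ) (hβ : β ≠ 0) (j : ℕ) :
    coeffZero α β ρ j = genStirling (j + 1) 1 α β ρ / ((j + 1).factorial : ℂ) := by
  have h0 := genFactorial_eq_sum_genStirling (j + 1) 0 α β ρ
  have h1 := genFactorial_eq_sum_genStirling (j + 1) 1 α β ρ
  simp only [Finset.sum_range_succ, Finset.sum_range_zero] at h0 h1
  simp at h0 h1
  rw [coeffZero, h0, h1, ← h0]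
  field_simp
  ring

theorem mk_coeffEps (α β ρ : ℂ) (ε : ℝ) :
    PowerSeries.mk (coeffEps α β ρ ε) = differenceSeries α β ρ (Complex.exp ε) := by
  ext n
  rw [PowerSeries.coeff_mk, coeff_differenceSeries, coeffEps]

theorem X_mul_mk_coeffZero (α β ρ : ℂ) :
    PowerSeries.X * PowerSeries.mk (coeffZero α β ρ) = differenceSeries α β ρ 1 := by
  ext n
  rw [coeff_differenceSeries]
  rcases n with _ | n
  · simp [genFactorial]
  · rw [PowerSeries.coeff_succ_X_mul, PowerSeries.coeff_mk, coeffZero, one_mul]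

theorem normStirlingEps_eq_coeff_pow (α β r : ℂ) (ε : ℝ) (n : ℕ) {μ : ℕ} (hμ : μ ≠ 0) :
    normStirlingEps α β r ε n μ =
      PowerSeries.coeff n (PowerSeries.mk (coeffEps α β (r / μ) ε) ^ μ) /
        fallingFactorial μ n := by
  have hμ' : (μ : ℂ) ≠ 0 := by exact_mod_cast hμ
  have hn : (n.factorial : ℂ) ≠ 0 := by exact_mod_cast n.factorial_ne_zero
  rw [normStirlingEps, mk_coeffEps,
    genStirlingFun_eq_coeff_pow n μ α β r (r / μ) ε (mul_div_cancel₀ r hμ'),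
    mul_comm, mul_div_mul_right _ _ hn]

theorem normStirlingZero_eq_coeff_pow (α β r : ℂ) (hβ : β ≠ 0) (n : ℕ) {μ : ℕ} (hμ : μ ≠ 0) :
    normStirlingZero α β r n μ =
      PowerSeries.coeff n (PowerSeries.mk (coeffZero α β (r / μ)) ^ μ) /
        fallingFactorial μ n := by
  have hμ' : (μ : ℂ) ≠ 0 := by exact_mod_cast hμ
  have hm : (μ.factorial : ℂ) ≠ 0 := by exact_mod_cast μ.factorial_ne_zero
  have h := genStirling_eq_coeff_pow (n + μ) μ α β r (r / μ) hβ (mul_div_cancel₀ r hμ')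
  rw [← X_mul_mk_coeffZero, mul_pow, PowerSeries.coeff_X_pow_mul] at h
  have h2 : fallingFactorial ((n : ℂ) + μ) n * μ.factorial = (n + μ).factorial := by
    rw [← Nat.cast_add, fallingFactorial_natCast, mul_comm]
    have := Nat.factorial_mul_descFactorial (show n ≤ n + μ by omega)
    rw [Nat.add_sub_cancel_left] at this
    exact_mod_cast this
  have h3 : fallingFactorial ((n : ℂ) + μ) n ≠ 0 := by
    intro h0
    rw [h0, zero_mul] at h2
    exact (n + μ).factorial_ne_zero (by exact_mod_cast h2.symm)
  have h4 : genStirling (n + μ) μ α β r = fallingFactorial ((n : ℂ) + μ) n *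
      PowerSeries.coeff n (PowerSeries.mk (coeffZero α β (r / μ)) ^ μ) := by
    refine mul_left_cancel₀ hm ?_
    rw [h, ← h2]
    ring
  rw [normStirlingZero, h4, mul_comm, mul_div_mul_right _ _ h3]

/-! ### The finite expansion -/

theorem coeff_pow_eq_sum_partitionSum (a : ℕ → ℂ) {n μ : ℕ} (hn : n ≤ μ) :
    PowerSeries.coeff n (PowerSeries.mk a ^ μ) = ∑ j ∈ Finset.range (n + 1),
      (μ.descFactorial (n - j) : ℂ) * a 0 ^ (μ - n + j) * partitionSum a n j := by
  have hA : PowerSeries.mk a = PowerSeries.X * (PowerSeries.mk fun i => a (i + 1)) +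
      PowerSeries.C (a 0) := by
    ext i
    rcases i with _ | i
    · simp
    · simp [PowerSeries.coeff_succ_X_mul]
  have hterm (k : ℕ) : PowerSeries.coeff n ((PowerSeries.X *
      (PowerSeries.mk fun i => a (i + 1))) ^ k * PowerSeries.C (a 0) ^ (μ - k) *
        (μ.choose k : PowerSeries ℂ)) = if k ≤ n then
          (μ.descFactorial k : ℂ) * a 0 ^ (μ - k) * partitionSum a n (n - k) else 0 := by
    have hC : (μ.choose k : PowerSeries ℂ) = PowerSeries.C (μ.choose k : ℂ) := by simp
    rw [hC, ← map_pow, mul_assoc, ← map_mul, PowerSeries.coeff_mul_C, mul_pow,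
      PowerSeries.coeff_X_pow_mul']
    split_ifs with h
    · have hk : (k.factorial : ℂ) ≠ 0 := by exact_mod_cast k.factorial_ne_zero
      rw [partitionSum_eq_coeff_pow a (Nat.sub_le n k), Nat.sub_sub_self h,
        Nat.descFactorial_eq_factorial_mul_choose]
      push_cast
      field_simp
    · rw [zero_mul]
  rw [hA, add_pow, map_sum, Finset.sum_congr rfl fun k _ => hterm k,
    ← Finset.sum_range_reflect _ (n + 1)]
  rw [← Finset.sum_subset (Finset.range_mono (show n + 1 ≤ μ + 1 by omega))
    (fun k _ hk => if_neg (by rw [Finset.mem_range] at hk; omega))]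
  refine Finset.sum_congr rfl fun k hk => ?_
  rw [Finset.mem_range] at hk
  rw [if_pos (by omega), show n + 1 - 1 - k = n - k by omega, show n - (n - k) = k by omega,
    show μ - n + (n - k) = μ - k by omega]

theorem fallingFactorial_sub_add {n μ : ℕ} (hn : n ≤ μ) (j : ℕ) :
    fallingFactorial ((μ : ℂ) - n + j) j = ((μ - n + j).descFactorial j : ℂ) := by
  rw [← fallingFactorial_natCast]
  push_cast [hn]
  rfl

/-- The expansion is exact when it is not truncated. -/
theorem coeff_pow_div_eq_sum_expansionTerm (a : ℕ → ℂ) {n μ : ℕ} (hn : n ≤ μ) :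
    PowerSeries.coeff n (PowerSeries.mk a ^ μ) / fallingFactorial μ n =
      a 0 ^ (μ - n) * ∑ j ∈ Finset.range (n + 1), a 0 ^ j * expansionTerm a n μ j := by
  rw [coeff_pow_eq_sum_partitionSum a hn, Finset.sum_div, Finset.mul_sum]
  refine Finset.sum_congr rfl fun j hj => ?_
  rw [Finset.mem_range] at hj
  rw [expansionTerm, fallingFactorial_natCast, fallingFactorial_sub_add hn]
  have h : μ.descFactorial n = μ.descFactorial (n - j) * (μ - n + j).descFactorial j := by
    have := Nat.descFactorial_mul_descFactorial (n := μ) (show n - j ≤ n by omega)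
    rw [show μ - (n - j) = μ - n + j by omega, show n - (n - j) = j by omega] at this
    rw [← this, mul_comm]
  have h1 : (μ.descFactorial (n - j) : ℂ) ≠ 0 := by
    rw [Nat.cast_ne_zero, Ne, Nat.descFactorial_eq_zero_iff_lt]
    omega
  have h2 : ((μ - n + j).descFactorial j : ℂ) ≠ 0 := by
    rw [Nat.cast_ne_zero, Ne, Nat.descFactorial_eq_zero_iff_lt]
    omega
  rw [h, pow_add]
  push_cast
  field_simp

theorem coeff_pow_div_sub_eq_sum_expansionTerm (a : ℕ → ℂ) {n μ : ℕ} (hn : n ≤ μ) (m : ℕ) :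
    PowerSeries.coeff n (PowerSeries.mk a ^ μ) / fallingFactorial μ n -
        a 0 ^ (μ - n) * ∑ j ∈ Finset.range (m + 1), a 0 ^ j * expansionTerm a n μ j =
      a 0 ^ (μ - n) * ∑ j ∈ Finset.Ico (m + 1) (n + m + 1), a 0 ^ j * expansionTerm a n μ j := by
  rw [coeff_pow_div_eq_sum_expansionTerm a hn, ← mul_sub, Finset.sum_subset
    (Finset.range_mono (show n + 1 ≤ n + m + 1 by omega)),
    ← Finset.sum_Ico_eq_sub _ (show m + 1 ≤ n + m + 1 by omega)]
  intro j _ hj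
  rw [Finset.mem_range] at hj
  rw [expansionTerm, partitionSum_eq_zero a (by omega), zero_div, mul_zero]

theorem coeffEps_zero (α β ρ : ℂ) (ε : ℝ) : coeffEps α β ρ ε 0 = (Complex.exp ε - 1) / β := by
  simp [coeffEps, genFactorial, div_eq_mul_inv, mul_comm]

theorem coeffZero_zero (α β ρ : ℂ) (hβ : β ≠ 0) : coeffZero α β ρ 0 = 1 := by
  simp [coeffZero, genFactorial, hβ]

theorem leadFactor_eq_pow (β : ℂ) (ε : ℝ) {n μ : ℕ} (hn : n ≤ μ) :
    leadFactor β ε n μ = ((Complex.exp ε - 1) / β) ^ (μ - n) := by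
  rw [leadFactor, ← inv_div, inv_zpow', neg_sub, ← Nat.cast_sub hn, zpow_natCast]

theorem remainderEps_eq_sum (α β r : ℂ) (ε : ℝ) (m : ℕ) {n μ : ℕ} (hn : n ≤ μ) (hμ : μ ≠ 0) :
    remainderEps α β r ε m n μ = leadFactor β ε n μ * ∑ j ∈ Finset.Ico (m + 1) (n + m + 1),
      ((Complex.exp ε - 1) / β) ^ j * expansionTerm (coeffEps α β (r / μ) ε) n μ j := by
  have h := coeff_pow_div_sub_eq_sum_expansionTerm (coeffEps α β (r / μ) ε) hn m
  rw [remainderEps, normStirlingEps_eq_coeff_pow α β r ε n hμ, leadFactor_eq_pow β ε hn]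
  rw [coeffEps_zero] at h
  exact h

theorem remainderZero_eq_sum (α β r : ℂ) (hβ : β ≠ 0) (m : ℕ) {n μ : ℕ} (hn : n ≤ μ)
    (hμ : μ ≠ 0) :
    remainderZero α β r m n μ = ∑ j ∈ Finset.Ico (m + 1) (n + m + 1),
      expansionTerm (coeffZero α β (r / μ)) n μ j := by
  have h := coeff_pow_div_sub_eq_sum_expansionTerm (coeffZero α β (r / μ)) hn m
  rw [remainderZero, normStirlingZero_eq_coeff_pow α β r hβ n hμ]
  rw [coeffZero_zero α β _ hβ] at h
  simpa using h

/-! ### Coefficients of large powers of a series -/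

theorem sum_range_two_pow_le (j : ℕ) : ∑ i ∈ Finset.range j, (2 : ℝ) ^ (j - 1 - i) ≤ 2 ^ j := by
  rw [Finset.sum_range_reflect (fun i => (2 : ℝ) ^ i) j, geom_sum_eq (by norm_num)]
  norm_num

/-- The factor `2 ^ j` majorizes the number of compositions of `j` into `l` parts. -/
theorem norm_coeff_pow_le {D : PowerSeries ℂ} {θ K : ℝ} (hθ : 0 ≤ θ) (hK : 0 ≤ K)
    (h0 : PowerSeries.coeff 0 D = 0)
    (hD : ∀ i, 1 ≤ i → ‖PowerSeries.coeff i D‖ ≤ θ * K ^ i) (l j : ℕ) :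
    ‖PowerSeries.coeff j (D ^ l)‖ ≤ θ ^ l * (2 * K) ^ j := by
  induction l generalizing j with
  | zero =>
    rw [pow_zero, PowerSeries.coeff_one]
    split_ifs with h
    · simp [h]
    · rw [norm_zero]
      positivity
  | succ l ih =>
    rw [pow_succ', PowerSeries.coeff_mul, Finset.Nat.sum_antidiagonal_eq_sum_range_succ_mk,
      Finset.sum_range_succ', h0, zero_mul, add_zero]
    calc ‖∑ i ∈ Finset.range j, PowerSeries.coeff (i + 1) D *
            PowerSeries.coeff (j - (i + 1)) (D ^ l)‖
        ≤ ∑ i ∈ Finset.range j, θ ^ (l + 1) * K ^ j * 2 ^ (j - 1 - i) := by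
          refine norm_sum_le_of_le _ fun i hi => ?_
          rw [Finset.mem_range] at hi
          rw [norm_mul]
          refine (mul_le_mul (hD (i + 1) (by omega)) (ih _) (norm_nonneg _)
            (by positivity)).trans (le_of_eq ?_)
          have h1 : K ^ j = K ^ (i + 1) * K ^ (j - (i + 1)) := by
            rw [← pow_add]
            congr 1
            omega
          rw [h1, show j - 1 - i = j - (i + 1) by omega, mul_pow]
          ring
      _ ≤ θ ^ (l + 1) * K ^ j * 2 ^ j := by
          rw [← Finset.mul_sum]
          exact mul_le_mul_of_nonneg_left (sum_range_two_pow_le j) (by positivity)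
      _ = θ ^ (l + 1) * (2 * K) ^ j := by rw [mul_pow]; ring

theorem coeff_one_add_pow {D : PowerSeries ℂ} (h0 : PowerSeries.coeff 0 D = 0) (N j : ℕ) :
    PowerSeries.coeff j ((1 + D) ^ N) =
      ∑ l ∈ Finset.range (j + 1), (N.choose l : ℂ) * PowerSeries.coeff j (D ^ l) := by
  have hX : PowerSeries.X ∣ D := PowerSeries.X_dvd_iff.2 (by simpa using h0)
  have hterm (l : ℕ) : PowerSeries.coeff j (D ^ l * 1 ^ (N - l) * (N.choose l : PowerSeries ℂ)) =
      (N.choose l : ℂ) * PowerSeries.coeff j (D ^ l) := by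
    have hC : (N.choose l : PowerSeries ℂ) = PowerSeries.C (N.choose l : ℂ) := by simp
    rw [one_pow, mul_one, hC, PowerSeries.coeff_mul_C, mul_comm]
  rw [add_comm, add_pow, map_sum, Finset.sum_congr rfl fun l _ => hterm l,
    Finset.sum_subset (Finset.range_mono (show N + 1 ≤ N + j + 1 by omega)),
    Finset.sum_subset (Finset.range_mono (show j + 1 ≤ N + j + 1 by omega))]
  · intro l _ hl
    rw [Finset.mem_range] at hl
    rw [PowerSeries.X_pow_dvd_iff.1 (pow_dvd_pow_of_dvd hX l) j (by omega), mul_zero]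
  · intro l _ hl
    rw [Finset.mem_range] at hl
    rw [Nat.choose_eq_zero_of_lt (by omega)]
    simp

theorem norm_choose_mul_coeff_pow_le {D : PowerSeries ℂ} {θ K : ℝ} (hθ : 0 ≤ θ) (hK : 0 ≤ K)
    (h0 : PowerSeries.coeff 0 D = 0)
    (hD : ∀ i, 1 ≤ i → ‖PowerSeries.coeff i D‖ ≤ θ * K ^ i) {N n : ℕ} (hN : N ≤ n) (l j : ℕ) :
    ‖(N.choose l : ℂ) * PowerSeries.coeff j (D ^ l)‖ ≤ (n * θ) ^ l * (2 * K) ^ j := by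
  have h1 : (N.choose l : ℝ) ≤ (n : ℝ) ^ l := by
    have : N.choose l ≤ n ^ l := (Nat.choose_le_pow N l).trans (Nat.pow_le_pow_left hN l)
    exact_mod_cast this
  rw [norm_mul, Complex.norm_natCast, mul_pow, mul_assoc]
  exact mul_le_mul h1 (norm_coeff_pow_le hθ hK h0 hD l j) (norm_nonneg _) (by positivity)

theorem norm_coeff_one_add_pow_le {D : PowerSeries ℂ} {θ K U : ℝ} (hθ : 0 ≤ θ) (hK : 0 ≤ K)
    (h0 : PowerSeries.coeff 0 D = 0)
    (hD : ∀ i, 1 ≤ i → ‖PowerSeries.coeff i D‖ ≤ θ * K ^ i) {N n j : ℕ} (hN : N ≤ n)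
    (hj : 1 ≤ j) (hU : ∀ l, 1 ≤ l → l ≤ j → (n * θ) ^ l ≤ U) :
    ‖PowerSeries.coeff j ((1 + D) ^ N)‖ ≤ U * (4 * K) ^ j := by
  have hU0 : 0 ≤ U := le_trans (by positivity) (hU 1 le_rfl hj)
  rw [coeff_one_add_pow h0, Finset.sum_range_succ', pow_zero, PowerSeries.coeff_one,
    if_neg (by omega), mul_zero, add_zero]
  calc ‖∑ l ∈ Finset.range j, (N.choose (l + 1) : ℂ) * PowerSeries.coeff j (D ^ (l + 1))‖
      ≤ ∑ l ∈ Finset.range j, U * (2 * K) ^ j := by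
        refine norm_sum_le_of_le _ fun l hl => ?_
        rw [Finset.mem_range] at hl
        refine (norm_choose_mul_coeff_pow_le hθ hK h0 hD hN (l + 1) j).trans ?_
        exact mul_le_mul_of_nonneg_right (hU (l + 1) (by omega) (by omega)) (by positivity)
    _ = j * (U * (2 * K) ^ j) := by simp
    _ ≤ 2 ^ j * (U * (2 * K) ^ j) := by
        refine mul_le_mul_of_nonneg_right ?_ (by positivity)
        exact_mod_cast (Nat.lt_two_pow_self (n := j)).le
    _ = U * (4 * K) ^ j := by
        rw [show (4 : ℝ) * K = 2 * (2 * K) by ring, mul_pow 2 (2 * K)]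
        ring

/-- If the linear coefficient of `D` stays away from zero, the `m`-th coefficient of
`(1 + D)^{n - m}` has exact order `nᵐ`: it is dominated by `(n - m choose m) d₁ᵐ`. -/
theorem exists_le_norm_coeff_one_add_pow {K δ : ℝ} (hK : 0 ≤ K) (hδ : 0 < δ) (m : ℕ) :
    ∃ c > 0, ∃ n₀ : ℕ, ∀ n ≥ n₀, ∀ D : PowerSeries ℂ, PowerSeries.coeff 0 D = 0 →
      (∀ i, 1 ≤ i → ‖PowerSeries.coeff i D‖ ≤ K ^ i) →
      (m = 0 ∨ δ ≤ ‖PowerSeries.coeff 1 D‖) →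
      c * (n : ℝ) ^ m ≤ ‖PowerSeries.coeff m ((1 + D) ^ (n - m))‖ := by
  set c : ℝ := (δ / 2) ^ m / (2 * m.factorial) with hc
  have hcpos : 0 < c := by positivity
  obtain ⟨n₁, hn₁⟩ := exists_nat_ge (m * (2 * K) ^ m / c)
  refine ⟨c, hcpos, n₁ + 4 * m + 1, fun n hn D h0 hD hm => ?_⟩
  have hn1 : (1 : ℝ) ≤ n := by exact_mod_cast (show 1 ≤ n by omega)
  rw [coeff_one_add_pow h0, Finset.sum_range_succ]
  have hmain : 2 * c * (n : ℝ) ^ m ≤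
      ‖((n - m).choose m : ℂ) * PowerSeries.coeff m (D ^ m)‖ := by
    have h1 : ‖PowerSeries.coeff m (D ^ m)‖ ≥ δ ^ m := by
      rcases hm with rfl | hm
      · simp
      · obtain ⟨E, hE⟩ := PowerSeries.X_dvd_iff.2
          (show PowerSeries.constantCoeff D = 0 by simpa using h0)
        have h2 : PowerSeries.coeff m (D ^ m) = PowerSeries.coeff 1 D ^ m := by
          rw [hE, mul_pow, show PowerSeries.coeff 1 (PowerSeries.X * E) =
            PowerSeries.coeff 0 E from PowerSeries.coeff_succ_X_mul 0 E]
          rw [PowerSeries.coeff_X_pow_mul', if_pos le_rfl, Nat.sub_self]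
          simp
        rw [h2, norm_pow]
        exact pow_le_pow_left₀ hδ.le hm m
    have h2 : ((n : ℝ) / 2) ^ m ≤ m.factorial * ((n - m).choose m : ℝ) := by
      have h3 := Nat.pow_sub_le_descFactorial (n - m) m
      rw [Nat.descFactorial_eq_factorial_mul_choose] at h3
      have h4 : (((n - m + 1 - m : ℕ) : ℝ)) ^ m ≤ m.factorial * ((n - m).choose m : ℝ) := by
        exact_mod_cast h3
      refine le_trans (pow_le_pow_left₀ (by positivity) ?_ m) h4
      rw [div_le_iff₀ (by norm_num)]
      exact_mod_cast (show n ≤ (n - m + 1 - m) * 2 by omega)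
    rw [norm_mul, Complex.norm_natCast]
    calc 2 * c * (n : ℝ) ^ m = ((n : ℝ) / 2) ^ m / m.factorial * δ ^ m := by
          rw [hc, div_pow, div_pow]
          field_simp
      _ ≤ ((n - m).choose m : ℝ) * ‖PowerSeries.coeff m (D ^ m)‖ := by
          refine mul_le_mul ?_ h1 (by positivity) (by positivity)
          rw [div_le_iff₀ (by positivity), mul_comm]
          exact h2
  have hrest : ‖∑ l ∈ Finset.range m, ((n - m).choose l : ℂ) * PowerSeries.coeff m (D ^ l)‖ ≤
      c * (n : ℝ) ^ m := by
    rcases m with _ | m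
    · simp only [Finset.range_zero, Finset.sum_empty, norm_zero]
      positivity
    calc _ ≤ ∑ l ∈ Finset.range (m + 1), (n : ℝ) ^ m * (2 * K) ^ (m + 1) := by
          refine norm_sum_le_of_le _ fun l hl => ?_
          rw [Finset.mem_range] at hl
          refine (norm_choose_mul_coeff_pow_le zero_le_one hK h0 (by simpa using hD)
            (Nat.sub_le n (m + 1)) l (m + 1)).trans ?_
          rw [mul_one]
          exact mul_le_mul_of_nonneg_right (pow_le_pow_right₀ hn1 (by omega)) (by positivity)
      _ = ((m + 1 : ℕ) * (2 * K) ^ (m + 1)) * (n : ℝ) ^ m := by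
          rw [Finset.sum_const, Finset.card_range, nsmul_eq_mul]
          ring
      _ ≤ (c * n) * (n : ℝ) ^ m := by
          refine mul_le_mul_of_nonneg_right ?_ (by positivity)
          rw [div_le_iff₀ hcpos] at hn₁
          refine hn₁.trans ?_
          rw [mul_comm c]
          refine mul_le_mul_of_nonneg_right ?_ hcpos.le
          exact_mod_cast (show n₁ ≤ n by omega)
      _ = c * (n : ℝ) ^ (m + 1) := by ring
  rw [add_comm (Finset.sum _ _)]
  refine le_trans ?_ (norm_sub_le_norm_add _ _)
  linarith

/-- If `D` is of size `θ` with `n θ` small, the `m`-th coefficient of `(1 + D)^{n - m}` has exact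
order `n θ`: it is dominated by the term `(n - m) d_m` which is linear in `D`. -/
theorem exists_le_norm_coeff_one_add_pow_of_small {K c : ℝ} (hK : 0 ≤ K) (hc : 0 < c) {m : ℕ}
    (hm : 1 ≤ m) :
    ∃ η > 0, ∀ n : ℕ, 2 * m ≤ n → ∀ θ : ℝ, 0 ≤ θ → n * θ ≤ η → ∀ D : PowerSeries ℂ,
      PowerSeries.coeff 0 D = 0 → (∀ i, 1 ≤ i → ‖PowerSeries.coeff i D‖ ≤ θ * K ^ i) →
      c * θ ≤ ‖PowerSeries.coeff m D‖ →
      c / 4 * (n * θ) ≤ ‖PowerSeries.coeff m ((1 + D) ^ (n - m))‖ := by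
  refine ⟨min 1 (c / (4 * (m * (2 * K) ^ m + 1))), lt_min one_pos (by positivity),
    fun n hn θ hθ hnθ D h0 hD hcm => ?_⟩
  obtain ⟨m, rfl⟩ : ∃ k, m = k + 1 := ⟨m - 1, by omega⟩
  have hnθ1 : n * θ ≤ 1 := hnθ.trans (min_le_left _ _)
  have hnθ2 : n * θ * (4 * ((m + 1 : ℕ) * (2 * K) ^ (m + 1) + 1)) ≤ c := by
    rw [← le_div_iff₀ (by positivity)]
    exact hnθ.trans (min_le_right _ _)
  have hnθ0 : 0 ≤ n * θ := by positivity
  rw [coeff_one_add_pow h0, Finset.sum_range_succ', pow_zero, PowerSeries.coeff_one,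
    if_neg (by omega), mul_zero, add_zero, Finset.sum_range_succ', zero_add, Nat.choose_one_right,
    pow_one]
  have hmain : c / 2 * (n * θ) ≤ ‖((n - (m + 1) : ℕ) : ℂ) * PowerSeries.coeff (m + 1) D‖ := by
    rw [norm_mul, Complex.norm_natCast]
    calc c / 2 * (n * θ) = (n / 2 : ℝ) * (c * θ) := by ring
      _ ≤ _ := by
          refine mul_le_mul ?_ hcm (by positivity) (by positivity)
          rw [div_le_iff₀ (by norm_num)]
          exact_mod_cast (show n ≤ (n - (m + 1)) * 2 by omega)
  have hrest : ‖∑ l ∈ Finset.range m, ((n - (m + 1)).choose (l + 1 + 1) : ℂ) *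
      PowerSeries.coeff (m + 1) (D ^ (l + 1 + 1))‖ ≤ c / 4 * (n * θ) := by
    calc _ ≤ ∑ l ∈ Finset.range m, (n * θ) ^ 2 * (2 * K) ^ (m + 1) := by
          refine norm_sum_le_of_le _ fun l _ => ?_
          refine (norm_choose_mul_coeff_pow_le hθ hK h0 hD
            (Nat.sub_le n (m + 1)) (l + 1 + 1) (m + 1)).trans ?_
          exact mul_le_mul_of_nonneg_right
            (pow_le_pow_of_le_one hnθ0 hnθ1 (by omega)) (by positivity)
      _ = (n * θ * (m * (2 * K) ^ (m + 1))) * (n * θ) := by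
          rw [Finset.sum_const, Finset.card_range, nsmul_eq_mul]
          ring
      _ ≤ c / 4 * (n * θ) := by
          refine mul_le_mul_of_nonneg_right ?_ hnθ0
          push_cast at hnθ2
          have h1 : 0 ≤ n * θ * (2 * K) ^ (m + 1) := by positivity
          nlinarith
  rw [add_comm (Finset.sum _ _)]
  refine le_trans ?_ (norm_sub_le_norm_add _ _)
  linarith

/-! ### Domination of the later terms by the term of order `m` -/

/-- For large `μ`, with `n = n(μ)` and `j > m`, the coefficient `[tʲ] B^{n - j}` is at most of order
`(C n)^{j - m}` relative to `[tᵐ] B^{n - m}`. -/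
def TailDominated (B : ℕ → PowerSeries ℂ) (m : ℕ) (n : ℕ → ℕ) : Prop :=
  ∃ L C : ℝ, 0 ≤ L ∧ 0 ≤ C ∧ ∀ᶠ μ in atTop, ∀ j, m < j → j ≤ n μ →
    ‖PowerSeries.coeff j (B μ ^ (n μ - j))‖ ≤
      L * C ^ j * (n μ : ℝ) ^ (j - m) * ‖PowerSeries.coeff m (B μ ^ (n μ - m))‖

/-- Domination only concerns the series up to a factor bounded away from zero. -/
theorem TailDominated.of_C_mul {B D : ℕ → PowerSeries ℂ} {b : ℕ → ℂ} {m : ℕ} {n : ℕ → ℕ} {s : ℝ}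
    (hs : 0 < s) (hb : ∀ᶠ μ in atTop, s ≤ ‖b μ‖)
    (hB : ∀ᶠ μ in atTop, B μ = PowerSeries.C (b μ) * D μ) (h : TailDominated D m n) :
    TailDominated B m n := by
  obtain ⟨L, C, hL, hC, h⟩ := h
  refine ⟨L * s ^ m, C / s, by positivity, by positivity, ?_⟩
  filter_upwards [h, hb, hB] with μ hμ hbμ hBμ j hmj hjn
  have hb0 : 0 < ‖b μ‖ := hs.trans_le hbμ
  rw [hBμ, mul_pow, mul_pow, ← map_pow, ← map_pow, PowerSeries.coeff_C_mul,
    PowerSeries.coeff_C_mul, norm_mul, norm_mul, norm_pow, norm_pow]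
  have h1 : ‖b μ‖ ^ (n μ - j) ≤ ‖b μ‖ ^ (n μ - m) / s ^ (j - m) := by
    rw [le_div_iff₀ (by positivity)]
    calc ‖b μ‖ ^ (n μ - j) * s ^ (j - m) ≤ ‖b μ‖ ^ (n μ - j) * ‖b μ‖ ^ (j - m) := by gcongr
      _ = ‖b μ‖ ^ (n μ - m) := by rw [← pow_add]; congr 1; omega
  calc _ ≤ ‖b μ‖ ^ (n μ - m) / s ^ (j - m) * (L * C ^ j * (n μ : ℝ) ^ (j - m) *
        ‖PowerSeries.coeff m (D μ ^ (n μ - m))‖) :=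
        mul_le_mul h1 (hμ j hmj hjn) (norm_nonneg _) (by positivity)
    _ = _ := by
        have h2 : s ^ j = s ^ m * s ^ (j - m) := by rw [← pow_add]; congr 1; omega
        rw [div_pow, h2]
        field_simp

theorem tailDominated_one_add {D : ℕ → PowerSeries ℂ} {K δ : ℝ} {m : ℕ} {n : ℕ → ℕ} (hK : 0 ≤ K)
    (hδ : 0 < δ) (hn : Tendsto n atTop atTop)
    (h0 : ∀ μ, PowerSeries.coeff 0 (D μ) = 0)
    (hD : ∀ᶠ μ in atTop, ∀ i, 1 ≤ i → ‖PowerSeries.coeff i (D μ)‖ ≤ K ^ i)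
    (hm : ∀ᶠ μ in atTop, m = 0 ∨ δ ≤ ‖PowerSeries.coeff 1 (D μ)‖) :
    TailDominated (fun μ => 1 + D μ) m n := by
  obtain ⟨c, hc, n₀, hlow⟩ := exists_le_norm_coeff_one_add_pow hK hδ m
  refine ⟨1 / c, 4 * K, by positivity, by positivity, ?_⟩
  filter_upwards [hD, hm, hn.eventually_ge_atTop n₀] with μ hDμ hmμ hnμ j hmj hjn
  have hn1 : (1 : ℝ) ≤ n μ := by exact_mod_cast (show 1 ≤ n μ by omega)
  have hup : ‖PowerSeries.coeff j ((1 + D μ) ^ (n μ - j))‖ ≤ (n μ : ℝ) ^ j * (4 * K) ^ j := by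
    refine norm_coeff_one_add_pow_le zero_le_one hK (h0 μ) (by simpa using hDμ)
      (Nat.sub_le _ _) (by omega) fun l _ hl => ?_
    rw [mul_one]
    exact pow_le_pow_right₀ hn1 hl
  refine hup.trans ?_
  calc (n μ : ℝ) ^ j * (4 * K) ^ j
      = 1 / c * (4 * K) ^ j * (n μ : ℝ) ^ (j - m) * (c * (n μ : ℝ) ^ m) := by
        have h2 : (n μ : ℝ) ^ j = (n μ : ℝ) ^ m * (n μ : ℝ) ^ (j - m) := by
          rw [← pow_add]; congr 1; omega
        rw [h2]
        field_simp
    _ ≤ _ := by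
        refine mul_le_mul_of_nonneg_left (hlow (n μ) hnμ (D μ) (h0 μ) hDμ hmμ) (by positivity)

theorem tailDominated_one_add_of_small {D : ℕ → PowerSeries ℂ} {θ : ℕ → ℝ} {K c : ℝ} {m : ℕ}
    {n : ℕ → ℕ} (hK : 0 ≤ K) (hc : 0 < c) (hm : 1 ≤ m) (hn : Tendsto n atTop atTop)
    (hθ : ∀ μ, 0 ≤ θ μ) (hnθ : Tendsto (fun μ => n μ * θ μ) atTop (nhds 0))
    (h0 : ∀ μ, PowerSeries.coeff 0 (D μ) = 0)
    (hD : ∀ᶠ μ in atTop, ∀ i, 1 ≤ i → ‖PowerSeries.coeff i (D μ)‖ ≤ θ μ * K ^ i)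
    (hcm : ∀ᶠ μ in atTop, c * θ μ ≤ ‖PowerSeries.coeff m (D μ)‖) :
    TailDominated (fun μ => 1 + D μ) m n := by
  obtain ⟨η, hη, hlow⟩ := exists_le_norm_coeff_one_add_pow_of_small hK hc hm
  refine ⟨4 / c, 4 * K, by positivity, by positivity, ?_⟩
  filter_upwards [hD, hcm, hn.eventually_ge_atTop (2 * m), hnθ.eventually_le_const hη,
    hnθ.eventually_le_const one_pos] with μ hDμ hcμ hnμ hημ h1μ j hmj hjn
  have hnθ0 : 0 ≤ n μ * θ μ := mul_nonneg (Nat.cast_nonneg _) (hθ μ)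
  have hn1 : (1 : ℝ) ≤ n μ := by exact_mod_cast (show 1 ≤ n μ by omega)
  have hup : ‖PowerSeries.coeff j ((1 + D μ) ^ (n μ - j))‖ ≤ (n μ * θ μ) * (4 * K) ^ j := by
    refine norm_coeff_one_add_pow_le (hθ μ) hK (h0 μ) hDμ
      (Nat.sub_le _ _) (by omega) fun l hl _ => ?_
    simpa using pow_le_pow_of_le_one hnθ0 h1μ hl
  calc _ ≤ (n μ * θ μ) * (4 * K) ^ j := hup
    _ = 4 / c * (4 * K) ^ j * 1 * (c / 4 * (n μ * θ μ)) := by field_simp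
    _ ≤ _ := by
        refine mul_le_mul ?_ (hlow (n μ) hnμ (θ μ) (hθ μ) hημ (D μ) (h0 μ) hDμ hcμ)
          (by positivity) (by positivity)
        exact mul_le_mul_of_nonneg_left (one_le_pow₀ hn1) (by positivity)

/-- A series normalized by its constant coefficient, with the constant coefficient removed. -/
noncomputable def normalizedTail (B : PowerSeries ℂ) : PowerSeries ℂ :=
  PowerSeries.mk fun i => if i = 0 then 0 else PowerSeries.coeff i B / PowerSeries.coeff 0 B

theorem coeff_zero_normalizedTail (B : PowerSeries ℂ) :
    PowerSeries.coeff 0 (normalizedTail B) = 0 := by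
  simp [normalizedTail]

theorem coeff_normalizedTail (B : PowerSeries ℂ) {i : ℕ} (hi : 1 ≤ i) :
    PowerSeries.coeff i (normalizedTail B) = PowerSeries.coeff i B / PowerSeries.coeff 0 B := by
  rw [normalizedTail, PowerSeries.coeff_mk, if_neg (by omega)]

theorem eq_C_mul_one_add_normalizedTail {B : PowerSeries ℂ} (hB : PowerSeries.coeff 0 B ≠ 0) :
    B = PowerSeries.C (PowerSeries.coeff 0 B) * (1 + normalizedTail B) := by
  ext i
  rw [PowerSeries.coeff_C_mul, map_add, PowerSeries.coeff_one]
  split_ifs with h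
  · rw [h, coeff_zero_normalizedTail, add_zero, mul_one]
  · rw [coeff_normalizedTail B (by omega), zero_add, mul_div_cancel₀ _ hB]

theorem tailDominated_of_coeff_one {B : ℕ → PowerSeries ℂ} {s M K : ℝ} {m : ℕ}
    {n : ℕ → ℕ} (hs : 0 < s) (hM : 0 < M) (hK : 0 ≤ K) (hn : Tendsto n atTop atTop)
    (hB0 : ∀ᶠ μ in atTop, s ≤ ‖PowerSeries.coeff 0 (B μ)‖)
    (hB : ∀ᶠ μ in atTop, ∀ i, ‖PowerSeries.coeff i (B μ)‖ ≤ M * K ^ i)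
    (hm : m = 0 ∨ ∃ δ > 0, ∀ᶠ μ in atTop, δ ≤ ‖PowerSeries.coeff 1 (B μ)‖) :
    TailDominated B m n := by
  obtain ⟨δ, hδ, hm⟩ : ∃ δ > 0, ∀ᶠ μ in atTop, m = 0 ∨ δ ≤ ‖PowerSeries.coeff 1 (B μ)‖ := by
    rcases hm with h | ⟨δ, hδ, h⟩
    · exact ⟨1, one_pos, Eventually.of_forall fun _ => Or.inl h⟩
    · exact ⟨δ, hδ, h.mono fun _ => Or.inr⟩
  refine TailDominated.of_C_mul hs hB0 (D := fun μ => 1 + normalizedTail (B μ)) ?_ ?_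
  · filter_upwards [hB0] with μ hμ
    exact eq_C_mul_one_add_normalizedTail (norm_pos_iff.1 (hs.trans_le hμ))
  · refine tailDominated_one_add (K := max 1 (M / s) * K) (δ := δ / M) (by positivity)
      (by positivity) hn (fun μ => coeff_zero_normalizedTail _) ?_ ?_
    · filter_upwards [hB0, hB] with μ h0μ hBμ i hi
      rw [coeff_normalizedTail _ hi, norm_div, div_le_iff₀ (hs.trans_le h0μ), mul_pow]
      have h1 : M ≤ max 1 (M / s) ^ i * s := by
        rw [← div_le_iff₀ hs]
        exact (le_max_right 1 _).trans (le_self_pow₀ (le_max_left _ _) (by omega))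
      calc _ ≤ M * K ^ i := hBμ i
        _ ≤ max 1 (M / s) ^ i * s * K ^ i := by gcongr
        _ ≤ max 1 (M / s) ^ i * ‖PowerSeries.coeff 0 (B μ)‖ * K ^ i := by gcongr
        _ = _ := by ring
    · filter_upwards [hB0, hB, hm] with μ h0μ hBμ hmμ
      refine hmμ.imp id fun h => ?_
      have hM' := hBμ 0
      rw [pow_zero, mul_one] at hM'
      rw [coeff_normalizedTail _ le_rfl, norm_div]
      exact div_le_div₀ (norm_nonneg _) h (hs.trans_le h0μ) hM'

theorem tailDominated_of_small {B : ℕ → PowerSeries ℂ} {θ : ℕ → ℝ} {s M K c : ℝ} {m : ℕ}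
    {n : ℕ → ℕ} (hs : 0 < s) (hM : 0 < M) (hK : 0 ≤ K) (hc : 0 < c) (hm : 1 ≤ m)
    (hn : Tendsto n atTop atTop) (hθ : ∀ μ, 0 ≤ θ μ)
    (hnθ : Tendsto (fun μ => n μ * θ μ) atTop (nhds 0))
    (hB0 : ∀ᶠ μ in atTop, s ≤ ‖PowerSeries.coeff 0 (B μ)‖)
    (hB0' : ∀ᶠ μ in atTop, ‖PowerSeries.coeff 0 (B μ)‖ ≤ M)
    (hB : ∀ᶠ μ in atTop, ∀ i, 1 ≤ i → ‖PowerSeries.coeff i (B μ)‖ ≤ θ μ * (M * K ^ i))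
    (hcm : ∀ᶠ μ in atTop, c * θ μ ≤ ‖PowerSeries.coeff m (B μ)‖) :
    TailDominated B m n := by
  refine TailDominated.of_C_mul hs hB0 (D := fun μ => 1 + normalizedTail (B μ)) ?_ ?_
  · filter_upwards [hB0] with μ hμ
    exact eq_C_mul_one_add_normalizedTail (norm_pos_iff.1 (hs.trans_le hμ))
  · refine tailDominated_one_add_of_small (θ := θ) (K := max 1 (M / s) * K) (c := c / M)
      (by positivity) (by positivity) hm hn hθ hnθ (fun μ => coeff_zero_normalizedTail _) ?_ ?_
    · filter_upwards [hB0, hB] with μ h0μ hBμ i hi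
      have hθμ := hθ μ
      rw [coeff_normalizedTail _ hi, norm_div, div_le_iff₀ (hs.trans_le h0μ), mul_pow]
      have h1 : M ≤ max 1 (M / s) ^ i * s := by
        rw [← div_le_iff₀ hs]
        exact (le_max_right 1 _).trans (le_self_pow₀ (le_max_left _ _) (by omega))
      calc _ ≤ θ μ * (M * K ^ i) := hBμ i hi
        _ ≤ θ μ * (max 1 (M / s) ^ i * s * K ^ i) := by gcongr
        _ ≤ θ μ * (max 1 (M / s) ^ i * ‖PowerSeries.coeff 0 (B μ)‖ * K ^ i) := by gcongr
        _ = _ := by ring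
    · filter_upwards [hB0, hB0', hcm] with μ h0μ h0μ' hmμ
      rw [coeff_normalizedTail _ hm, norm_div, div_mul_eq_mul_div]
      exact div_le_div₀ (norm_nonneg _) hmμ (hs.trans_le h0μ) h0μ'

/-! ### Comparison of the remainder with the last term kept -/

theorem norm_expansionTerm (a : ℕ → ℂ) {n μ j : ℕ} (hn : n ≤ μ) (hj : j ≤ n) :
    ‖expansionTerm a n μ j‖ =
      ‖PowerSeries.coeff j ((PowerSeries.mk fun i => a (i + 1)) ^ (n - j))‖ /
        ((n - j).factorial * (μ - n + j).descFactorial j) := by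
  rw [expansionTerm, partitionSum_eq_coeff_pow a hj, fallingFactorial_sub_add hn, div_div,
    norm_div, norm_mul, Complex.norm_natCast, Complex.norm_natCast]

theorem norm_pow_mul_expansionTerm_le {a : ℕ → ℂ} {n μ m j : ℕ} {L C A : ℝ} (hL : 0 ≤ L)
    (hC : 0 ≤ C) (hA : 0 ≤ A) (hn1 : 1 ≤ n) (hn : 2 * n ≤ μ) (hmj : m < j) (hjn : j ≤ n)
    (h : ‖PowerSeries.coeff j ((PowerSeries.mk fun i => a (i + 1)) ^ (n - j))‖ ≤
      L * C ^ j * (n : ℝ) ^ (j - m) *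
        ‖PowerSeries.coeff m ((PowerSeries.mk fun i => a (i + 1)) ^ (n - m))‖) :
    A ^ j * ‖expansionTerm a n μ j‖ ≤
      L * (A * C) ^ m * (2 * A * C * ((n : ℝ) ^ 2 / μ)) ^ (j - m) * ‖expansionTerm a n μ m‖ := by
  have hμ : (0 : ℝ) < μ := by exact_mod_cast (show 0 < μ by omega)
  rw [norm_expansionTerm a (by omega) hjn, norm_expansionTerm a (by omega) (by omega)]
  set G := ‖PowerSeries.coeff m ((PowerSeries.mk fun i => a (i + 1)) ^ (n - m))‖
  have hG : 0 ≤ G := norm_nonneg _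
  obtain ⟨d, rfl⟩ : ∃ d, j = m + d := ⟨j - m, by omega⟩
  rw [Nat.add_sub_cancel_left] at h ⊢
  have hfac : ((n - m).factorial : ℝ) ≤ (n - (m + d)).factorial * (n : ℝ) ^ d := by
    have h1 : (n - m).factorial ≤ (n - (m + d)).factorial * n ^ d := by
      have h2 := Nat.factorial_mul_descFactorial (show d ≤ n - m by omega)
      rw [Nat.sub_sub] at h2
      rw [← h2]
      refine Nat.mul_le_mul_left _ ((Nat.descFactorial_le_pow _ _).trans ?_)
      exact Nat.pow_le_pow_left (Nat.sub_le n m) d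
    exact_mod_cast h1
  have hdesc : ((μ - n + m).descFactorial m : ℝ) * (μ / 2 : ℝ) ^ d ≤
      (μ - n + (m + d)).descFactorial (m + d) := by
    have h1 : (μ - n + m).descFactorial m * (μ - n) ^ d ≤
        (μ - n + (m + d)).descFactorial (m + d) := by
      have h2 := Nat.descFactorial_mul_descFactorial (n := μ - n + (m + d))
        (show d ≤ m + d by omega)
      rw [Nat.add_sub_cancel, show μ - n + (m + d) - d = μ - n + m by omega] at h2
      rw [← h2]
      refine Nat.mul_le_mul_left _ (le_trans ?_ (Nat.pow_sub_le_descFactorial _ d))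
      exact Nat.pow_le_pow_left (by omega) d
    refine le_trans (mul_le_mul_of_nonneg_left (pow_le_pow_left₀ (by positivity) ?_ d)
      (Nat.cast_nonneg _)) (show ((μ - n + m).descFactorial m : ℝ) * ((μ - n : ℕ) : ℝ) ^ d ≤ _ by
        exact_mod_cast h1)
    rw [div_le_iff₀ (by norm_num)]
    exact_mod_cast (show μ ≤ (μ - n) * 2 by omega)
  have hpos1 : (0 : ℝ) < (n - m).factorial := by exact_mod_cast (n - m).factorial_pos
  have hpos2 : (0 : ℝ) < (n - (m + d)).factorial := by exact_mod_cast Nat.factorial_pos _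
  have hpos3 : (0 : ℝ) < (μ - n + m).descFactorial m := by
    exact_mod_cast Nat.descFactorial_pos.2 (by omega)
  have hn0 : (0 : ℝ) < n := by exact_mod_cast hn1
  calc A ^ (m + d) * (_ / ((n - (m + d)).factorial *
          ((μ - n + (m + d)).descFactorial (m + d) : ℝ)))
      ≤ A ^ (m + d) * ((L * C ^ (m + d) * (n : ℝ) ^ d * G) /
          (((n - m).factorial / (n : ℝ) ^ d) *
            ((μ - n + m).descFactorial m * (μ / 2 : ℝ) ^ d))) := by
        refine mul_le_mul_of_nonneg_left (div_le_div₀ (by positivity) h (by positivity) ?_)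
          (by positivity)
        refine mul_le_mul ?_ hdesc (by positivity) (by positivity)
        rw [div_le_iff₀ (by positivity)]
        exact hfac
    _ = _ := by
        simp only [mul_pow, div_pow, pow_add]
        field_simp
        ring

/-- The sum of the terms beyond order `m` is a geometric series of ratio `O(n² / μ)`. -/
theorem norm_sum_expansionTerm_le {a : ℕ → ℂ} {n μ m : ℕ} {L C : ℝ} (hL : 0 ≤ L) (hC : 0 ≤ C)
    (hn1 : 1 ≤ n) (hn : 2 * n ≤ μ) (c : ℂ) (hx : 2 * ‖c‖ * C * ((n : ℝ) ^ 2 / μ) ≤ 1 / 2)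
    (h : ∀ j, m < j → j ≤ n →
      ‖PowerSeries.coeff j ((PowerSeries.mk fun i => a (i + 1)) ^ (n - j))‖ ≤
        L * C ^ j * (n : ℝ) ^ (j - m) *
          ‖PowerSeries.coeff m ((PowerSeries.mk fun i => a (i + 1)) ^ (n - m))‖) :
    ‖∑ j ∈ Finset.Ico (m + 1) (n + m + 1), c ^ j * expansionTerm a n μ j‖ ≤
      2 * L * (‖c‖ * C) ^ m * (2 * ‖c‖ * C * ((n : ℝ) ^ 2 / μ)) * ‖expansionTerm a n μ m‖ := by
  set x := 2 * ‖c‖ * C * ((n : ℝ) ^ 2 / μ)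
  have hx0 : 0 ≤ x := by positivity
  have hterm : ∀ j ∈ Finset.Ico (m + 1) (n + m + 1), ‖c ^ j * expansionTerm a n μ j‖ ≤
      L * (‖c‖ * C) ^ m * x ^ (j - m) * ‖expansionTerm a n μ m‖ := by
    intro j hj
    rw [Finset.mem_Ico] at hj
    rcases le_or_gt j n with hjn | hjn
    · rw [norm_mul, norm_pow]
      exact norm_pow_mul_expansionTerm_le hL hC (norm_nonneg c) hn1 hn (by omega) hjn
        (h j (by omega) hjn)
    · rw [expansionTerm, partitionSum_eq_zero a hjn, zero_div, mul_zero, norm_zero]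
      positivity
  have hgeom : ∑ j ∈ Finset.Ico (m + 1) (n + m + 1), x ^ (j - m) ≤ 2 * x := by
    rw [Finset.sum_Ico_eq_sum_range]
    have hsum : ∑ i ∈ Finset.range n, x ^ i ≤ 2 := by
      have h1 : (∑ i ∈ Finset.range n, x ^ i) * (1 - x) = 1 - x ^ n := geom_sum_mul_neg x n
      have h2 : 0 ≤ x ^ n := by positivity
      have h3 : 0 ≤ ∑ i ∈ Finset.range n, x ^ i := by positivity
      nlinarith
    calc ∑ k ∈ Finset.range (n + m + 1 - (m + 1)), x ^ (m + 1 + k - m)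
        = x * ∑ i ∈ Finset.range n, x ^ i := by
          rw [Finset.mul_sum, show n + m + 1 - (m + 1) = n by omega]
          refine Finset.sum_congr rfl fun k _ => ?_
          rw [show m + 1 + k - m = k + 1 by omega, pow_succ']
      _ ≤ x * 2 := mul_le_mul_of_nonneg_left hsum hx0
      _ = 2 * x := mul_comm _ _
  calc _ ≤ ∑ j ∈ Finset.Ico (m + 1) (n + m + 1),
        L * (‖c‖ * C) ^ m * x ^ (j - m) * ‖expansionTerm a n μ m‖ := norm_sum_le_of_le _ hterm
    _ = L * (‖c‖ * C) ^ m * (∑ j ∈ Finset.Ico (m + 1) (n + m + 1), x ^ (j - m)) *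
        ‖expansionTerm a n μ m‖ := by rw [Finset.mul_sum, Finset.sum_mul]
    _ ≤ L * (‖c‖ * C) ^ m * (2 * x) * ‖expansionTerm a n μ m‖ := by gcongr
    _ = _ := by ring

theorem tendsto_sq_div_of_isLittleO_sqrt {n : ℕ → ℕ}
    (h : (fun μ : ℕ => (n μ : ℝ)) =o[atTop] fun μ : ℕ => (μ : ℝ) ^ (1 / 2 : ℝ)) :
    Tendsto (fun μ : ℕ => (n μ : ℝ) ^ 2 / μ) atTop (nhds 0) := by
  have h1 := (h.tendsto_div_nhds_zero).pow 2
  rw [zero_pow two_ne_zero] at h1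
  refine h1.congr fun μ => ?_
  rw [div_pow, ← Real.sqrt_eq_rpow, Real.sq_sqrt (Nat.cast_nonneg μ)]

theorem eventually_mul_two_le {n : ℕ → ℕ} (hn : Tendsto n atTop atTop)
    (h : Tendsto (fun μ : ℕ => (n μ : ℝ) ^ 2 / μ) atTop (nhds 0)) :
    ∀ᶠ μ in atTop, 2 * n μ ≤ μ := by
  filter_upwards [hn.eventually_ge_atTop 1,
    h.eventually_le_const (show (0 : ℝ) < 1 / 2 by norm_num),
    eventually_gt_atTop 0] with μ h1 h2 h3
  rw [div_le_iff₀ (by exact_mod_cast h3)] at h2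
  have h4 : (1 : ℝ) ≤ n μ := by exact_mod_cast h1
  have h5 : (2 * n μ : ℝ) ≤ μ := by nlinarith
  exact_mod_cast h5

/-- If the coefficients are tail-dominated, the terms beyond order `m` are negligible against the
term of order `m`, as `n² / μ → 0`. -/
theorem isLittleO_sum_expansionTerm {a : ℕ → ℕ → ℂ} {m : ℕ} {n : ℕ → ℕ} (c : ℂ)
    (hn : Tendsto n atTop atTop)
    (hno : (fun μ : ℕ => (n μ : ℝ)) =o[atTop] fun μ : ℕ => (μ : ℝ) ^ (1 / 2 : ℝ))
    (h : TailDominated (fun μ => PowerSeries.mk fun i => a μ (i + 1)) m n) :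
    (fun μ => ∑ j ∈ Finset.Ico (m + 1) (n μ + m + 1), c ^ j * expansionTerm (a μ) (n μ) μ j)
      =o[atTop] fun μ => expansionTerm (a μ) (n μ) μ m := by
  obtain ⟨L, C, hL, hC, h⟩ := h
  have hsq := tendsto_sq_div_of_isLittleO_sqrt hno
  have hx : Tendsto (fun μ : ℕ => 2 * ‖c‖ * C * ((n μ : ℝ) ^ 2 / μ)) atTop (nhds 0) := by
    simpa using hsq.const_mul (2 * ‖c‖ * C)
  have hO : (fun μ => ∑ j ∈ Finset.Ico (m + 1) (n μ + m + 1),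
      c ^ j * expansionTerm (a μ) (n μ) μ j) =O[atTop]
        fun μ : ℕ => (2 * ‖c‖ * C * ((n μ : ℝ) ^ 2 / μ)) * ‖expansionTerm (a μ) (n μ) μ m‖ := by
    refine IsBigO.of_bound (2 * L * (‖c‖ * C) ^ m) ?_
    filter_upwards [h, hn.eventually_ge_atTop 1, eventually_mul_two_le hn hsq,
      hx.eventually_le_const (show (0 : ℝ) < 1 / 2 by norm_num)] with μ hμ h1 h2 h3
    refine (norm_sum_expansionTerm_le hL hC h1 h2 c h3 hμ).trans (le_of_eq ?_)
    rw [Real.norm_of_nonneg (by positivity)]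
    ring
  refine hO.trans_isLittleO ?_
  have h1 := ((isLittleO_one_iff ℝ).2 hx).mul_isBigO
    (isBigO_refl (fun μ => ‖expansionTerm (a μ) (n μ) μ m‖) atTop)
  simp only [one_mul] at h1
  exact h1.norm_right.trans_isBigO (isBigO_of_le _ fun μ => by simp)

/-! ### The expansion for fixed `n` -/

theorem isBigO_inv_descFactorial (n : ℕ) {m j : ℕ} (hmj : m < j) :
    (fun μ : ℕ => (fallingFactorial ((μ : ℂ) - n + j) j)⁻¹) =O[atTop]
      fun μ : ℕ => ((μ : ℂ) ^ (m + 1))⁻¹ := by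
  refine IsBigO.of_bound (2 ^ j) ?_
  filter_upwards [eventually_ge_atTop (2 * n + 1)] with μ hμ
  have hμ1 : (1 : ℝ) ≤ μ := by exact_mod_cast (show 1 ≤ μ by omega)
  rw [fallingFactorial_sub_add (by omega), norm_inv, norm_inv, norm_pow, Complex.norm_natCast,
    Complex.norm_natCast]
  have h1 : ((μ : ℝ) / 2) ^ j ≤ ((μ - n + j).descFactorial j : ℝ) := by
    have h2 : (μ - n + j + 1 - j) ^ j ≤ (μ - n + j).descFactorial j :=
      Nat.pow_sub_le_descFactorial _ _
    refine le_trans (pow_le_pow_left₀ (by positivity) ?_ j)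
      (show ((μ - n + j + 1 - j : ℕ) : ℝ) ^ j ≤ _ by exact_mod_cast h2)
    rw [div_le_iff₀ (by norm_num)]
    exact_mod_cast (show μ ≤ (μ - n + j + 1 - j) * 2 by omega)
  calc _ ≤ (((μ : ℝ) / 2) ^ j)⁻¹ := inv_anti₀ (by positivity) h1
    _ = 2 ^ j * ((μ : ℝ) ^ j)⁻¹ := by rw [div_pow, inv_div, div_eq_mul_inv]
    _ ≤ 2 ^ j * ((μ : ℝ) ^ (m + 1))⁻¹ := by
        gcongr
        omega

theorem isBigO_expansionTerm {a : ℕ → ℕ → ℂ} {l : ℕ → ℂ} (n : ℕ) {m j : ℕ} (hmj : m < j)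
    (ha : ∀ i, Tendsto (fun μ => a μ i) atTop (nhds (l i))) :
    (fun μ : ℕ => expansionTerm (a μ) n μ j) =O[atTop] fun μ : ℕ => ((μ : ℂ) ^ (m + 1))⁻¹ := by
  have hW : Tendsto (fun μ => partitionSum (a μ) n j) atTop (nhds (partitionSum l n j)) := by
    unfold partitionSum
    refine tendsto_finsetSum _ fun p _ => tendsto_finsetProd _ fun i _ => ?_
    exact ((ha i).pow _).div_const _
  have h := (hW.isBigO_one ℂ).mul (isBigO_inv_descFactorial n hmj)
  simp only [one_mul] at h
  exact h

theorem isBigO_sum_expansionTerm {a : ℕ → ℕ → ℂ} {l : ℕ → ℂ} (c : ℂ) (m n : ℕ)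
    (ha : ∀ i, Tendsto (fun μ => a μ i) atTop (nhds (l i))) :
    (fun μ => ∑ j ∈ Finset.Ico (m + 1) (n + m + 1), c ^ j * expansionTerm (a μ) n μ j)
      =O[atTop] fun μ : ℕ => ((μ : ℂ) ^ (m + 1))⁻¹ := by
  refine IsBigO.fun_sum fun j hj => ?_
  rw [Finset.mem_Ico] at hj
  exact (isBigO_expansionTerm n (by omega) ha).const_mul_left _

/-! ### Bounds and limits for the coefficients -/

theorem norm_coeff_factorialSeries_le {α z : ℂ} {K : ℝ} (hα : ‖α‖ ≤ K) (hz : ‖z‖ ≤ K) (n : ℕ) :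
    ‖PowerSeries.coeff n (factorialSeries α z)‖ ≤ K ^ n := by
  have hK : 0 ≤ K := (norm_nonneg _).trans hz
  induction n with
  | zero => simp [coeff_factorialSeries, genFactorial]
  | succ n ih =>
    have h := congrArg norm (coeff_succ_factorialSeries α z n)
    have h1 : ‖(n : ℂ) + 1‖ = n + 1 := by exact_mod_cast Complex.norm_natCast (n + 1)
    have h2 : ‖z - n * α‖ ≤ K * (n + 1) := by
      refine (norm_sub_le _ _).trans ?_
      rw [norm_mul, Complex.norm_natCast]
      nlinarith [mul_le_mul_of_nonneg_left hα (Nat.cast_nonneg (α := ℝ) n)]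
    rw [norm_mul, norm_mul, h1] at h
    refine le_of_mul_le_mul_right ?_ (show (0 : ℝ) < n + 1 by positivity)
    calc _ = ‖z - n * α‖ * ‖PowerSeries.coeff n (factorialSeries α z)‖ := h
      _ ≤ K * (n + 1) * K ^ n := mul_le_mul h2 ih (norm_nonneg _) (by positivity)
      _ = _ := by ring

theorem norm_coeff_factorialSeries_sub_le {α z w : ℂ} {K : ℝ} (hα : ‖α‖ ≤ K) (hz : ‖z‖ ≤ K)
    (hw : ‖w‖ ≤ K) (n : ℕ) :
    ‖PowerSeries.coeff n (factorialSeries α z) - PowerSeries.coeff n (factorialSeries α w)‖ ≤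
      ‖z - w‖ * (K + 1) ^ n := by
  have hK : 0 ≤ K := (norm_nonneg _).trans hz
  induction n with
  | zero => simp [coeff_factorialSeries, genFactorial]
  | succ n ih =>
    set e := fun x => PowerSeries.coeff n (factorialSeries α x)
    have h : (PowerSeries.coeff (n + 1) (factorialSeries α z) -
        PowerSeries.coeff (n + 1) (factorialSeries α w)) * ((n : ℂ) + 1) =
          (z - n * α) * (e z - e w) + (z - w) * e w := by
      rw [sub_mul, coeff_succ_factorialSeries, coeff_succ_factorialSeries]
      ring
    have h1 : ‖(n : ℂ) + 1‖ = n + 1 := by exact_mod_cast Complex.norm_natCast (n + 1)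
    have h2 : ‖z - n * α‖ ≤ K * (n + 1) := by
      refine (norm_sub_le _ _).trans ?_
      rw [norm_mul, Complex.norm_natCast]
      nlinarith [mul_le_mul_of_nonneg_left hα (Nat.cast_nonneg (α := ℝ) n)]
    have h3 : ‖e w‖ ≤ (n + 1) * (K + 1) ^ n := by
      refine (norm_coeff_factorialSeries_le hα hw n).trans ?_
      calc K ^ n ≤ (K + 1) ^ n := by gcongr; linarith
        _ ≤ _ := le_mul_of_one_le_left (by positivity) (by linarith [Nat.cast_nonneg (α := ℝ) n])
    have h' := congrArg norm h
    rw [norm_mul, h1] at h'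
    refine le_of_mul_le_mul_right ?_ (show (0 : ℝ) < n + 1 by positivity)
    calc _ = ‖(z - n * α) * (e z - e w) + (z - w) * e w‖ := h'
      _ ≤ K * (n + 1) * (‖z - w‖ * (K + 1) ^ n) + ‖z - w‖ * ((n + 1) * (K + 1) ^ n) := by
          refine (norm_add_le _ _).trans ?_
          rw [norm_mul, norm_mul]
          gcongr
      _ = _ := by ring

theorem coeff_differenceSeries' (α β ρ w : ℂ) (n : ℕ) :
    PowerSeries.coeff n (differenceSeries α β ρ w) = 1 / β *
      (w * PowerSeries.coeff n (factorialSeries α (ρ + β)) -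
        PowerSeries.coeff n (factorialSeries α ρ)) := by
  rw [differenceSeries, PowerSeries.coeff_C_mul, map_sub, PowerSeries.coeff_C_mul]

theorem norm_coeff_differenceSeries_le (α β w : ℂ) {ρ : ℂ} (hρ : ‖ρ‖ ≤ 1) (n : ℕ) :
    ‖PowerSeries.coeff n (differenceSeries α β ρ w)‖ ≤
      1 / ‖β‖ * (‖w‖ + 1) * (2 + ‖α‖ + ‖β‖) ^ n := by
  have hα := norm_nonneg α
  have hβ := norm_nonneg β
  have h1 := norm_coeff_factorialSeries_le (α := α) (z := ρ + β) (K := 2 + ‖α‖ + ‖β‖)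
    (by linarith) ((norm_add_le _ _).trans (by linarith)) n
  have h2 := norm_coeff_factorialSeries_le (α := α) (z := ρ) (K := 2 + ‖α‖ + ‖β‖)
    (by linarith) (by linarith) n
  rw [coeff_differenceSeries', norm_mul, norm_div, norm_one, mul_assoc]
  gcongr
  refine (norm_sub_le _ _).trans ?_
  rw [norm_mul, add_mul, one_mul]
  gcongr

theorem norm_coeff_differenceSeries_sub_le (α β w : ℂ) {ρ : ℂ} (hρ : ‖ρ‖ ≤ 1) (n : ℕ) :
    ‖PowerSeries.coeff n (differenceSeries α β ρ w) -
        PowerSeries.coeff n (differenceSeries α β 0 w)‖ ≤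
      ‖ρ‖ * (1 / ‖β‖ * (‖w‖ + 1) * (2 + ‖α‖ + ‖β‖) ^ n) := by
  have hα := norm_nonneg α
  have hβ := norm_nonneg β
  have h1 := norm_coeff_factorialSeries_sub_le (α := α) (z := ρ + β) (w := 0 + β)
    (K := 1 + ‖α‖ + ‖β‖) (by linarith) ((norm_add_le _ _).trans (by linarith))
    (by rw [zero_add]; linarith) n
  have h2 := norm_coeff_factorialSeries_sub_le (α := α) (z := ρ) (w := 0)
    (K := 1 + ‖α‖ + ‖β‖) (by linarith) (by linarith) (by rw [norm_zero]; linarith) n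
  rw [add_sub_add_right_eq_sub] at h1
  rw [sub_zero, show 1 + ‖α‖ + ‖β‖ + 1 = 2 + ‖α‖ + ‖β‖ by ring] at h1 h2
  rw [coeff_differenceSeries', coeff_differenceSeries', ← mul_sub, norm_mul, norm_div, norm_one,
    show ‖ρ‖ * (1 / ‖β‖ * (‖w‖ + 1) * (2 + ‖α‖ + ‖β‖) ^ n) =
      1 / ‖β‖ * (‖w‖ * (‖ρ‖ * (2 + ‖α‖ + ‖β‖) ^ n) + ‖ρ‖ * (2 + ‖α‖ + ‖β‖) ^ n) by ring,
    sub_sub_sub_comm, ← mul_sub]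
  gcongr
  refine (norm_sub_le _ _).trans ?_
  rw [norm_mul]
  gcongr

theorem tendsto_coeff_differenceSeries (α β r w : ℂ) (n : ℕ) :
    Tendsto (fun μ : ℕ => PowerSeries.coeff n (differenceSeries α β (r / μ) w)) atTop
      (nhds (PowerSeries.coeff n (differenceSeries α β 0 w))) := by
  have hcont : Continuous fun ρ : ℂ => PowerSeries.coeff n (differenceSeries α β ρ w) := by
    simp only [coeff_differenceSeries, genFactorial]
    fun_prop
  exact (hcont.tendsto 0).comp (tendsto_const_div_atTop_nhds_zero_nat r)

theorem exists_pos_eventually_le_norm {f : ℕ → ℂ} {l : ℂ} (hf : Tendsto f atTop (nhds l))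
    (hl : l ≠ 0) : ∃ δ > 0, ∀ᶠ μ in atTop, δ ≤ ‖f μ‖ := by
  have h : 0 < ‖l‖ := norm_pos_iff.2 hl
  exact ⟨‖l‖ / 2, by positivity, hf.norm.eventually_const_le (by linarith)⟩

theorem tailDominated_of_eq_zero {B : ℕ → PowerSeries ℂ} (hB : ∀ μ, B μ = 0) (m : ℕ)
    (n : ℕ → ℕ) : TailDominated B m n := by
  refine ⟨0, 0, le_rfl, le_rfl, Eventually.of_forall fun μ j hmj hj => ?_⟩
  rw [hB]
  rcases Nat.eq_zero_or_pos (n μ - j) with h | h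
  · rw [h, pow_zero, PowerSeries.coeff_one, if_neg (by omega)]
    simp
  · rw [zero_pow (by omega)]
    simp

/-- Domination for the coefficients of order `p, p + 1, …` of the difference series. Either the
second of them is nonzero in the limit, or all but the first vanish at `ρ = 0`; then the series
is of size `ρ = r / μ`, and `m` has to be such that the coefficient of order `m + p` vanishes to
first order only. -/
theorem tailDominated_differenceSeries {α β r w : ℂ} (hβ : β ≠ 0) (p m : ℕ) {n : ℕ → ℕ}
    (hn : Tendsto n atTop atTop)
    (hno : (fun μ : ℕ => (n μ : ℝ)) =o[atTop] fun μ : ℕ => (μ : ℝ) ^ (1 / 2 : ℝ))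
    (hp : PowerSeries.coeff p (differenceSeries α β 0 w) ≠ 0)
    (h : m = 0 ∨ PowerSeries.coeff (1 + p) (differenceSeries α β 0 w) ≠ 0 ∨
      ((∀ i, 1 ≤ i → PowerSeries.coeff (i + p) (differenceSeries α β 0 w) = 0) ∧
        (r = 0 ∨ ∃ g : ℂ → ℂ, Continuous g ∧ g 0 ≠ 0 ∧
          ∀ ρ, PowerSeries.coeff (m + p) (differenceSeries α β ρ w) = ρ * g ρ))) :
    TailDominated (fun μ : ℕ => PowerSeries.mk fun i =>
      PowerSeries.coeff (i + p) (differenceSeries α β (r / μ) w)) m n := by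
  set K : ℝ := 2 + ‖α‖ + ‖β‖
  have hK : 0 < K := by positivity
  set M : ℝ := 1 / ‖β‖ * (‖w‖ + 1) * K ^ p with hMdef
  have hM : 0 < M := by
    have := norm_pos_iff.2 hβ
    positivity
  have hρ : ∀ᶠ μ : ℕ in atTop, ‖r / (μ : ℂ)‖ ≤ 1 := by
    have h1 := (tendsto_const_div_atTop_nhds_zero_nat r).norm
    rw [norm_zero] at h1
    exact h1.eventually_le_const one_pos
  obtain ⟨s, hs, hB0⟩ := exists_pos_eventually_le_norm (tendsto_coeff_differenceSeries α β r w p) hp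
  have hB : ∀ᶠ μ : ℕ in atTop, ∀ i,
      ‖PowerSeries.coeff (i + p) (differenceSeries α β (r / μ) w)‖ ≤ M * K ^ i := by
    filter_upwards [hρ] with μ hμ i
    refine (norm_coeff_differenceSeries_le α β w hμ (i + p)).trans (le_of_eq ?_)
    rw [hMdef, pow_add]
    ring
  by_cases hgen : m = 0 ∨ PowerSeries.coeff (1 + p) (differenceSeries α β 0 w) ≠ 0
  · refine tailDominated_of_coeff_one hs hM hK.le hn (by simpa using hB0) (by simpa using hB) ?_
    refine hgen.imp id fun h1 => ?_
    simpa using exists_pos_eventually_le_norm (tendsto_coeff_differenceSeries α β r w (1 + p)) h1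
  · obtain ⟨hm, h1⟩ := not_or.1 hgen
    obtain ⟨hzero, hlow⟩ := (h.resolve_left hm).resolve_left h1
    obtain ⟨c, hc, hcm⟩ : ∃ c > 0, ∀ᶠ μ : ℕ in atTop, c * ‖r / (μ : ℂ)‖ ≤
        ‖PowerSeries.coeff (m + p) (differenceSeries α β (r / μ) w)‖ := by
      rcases hlow with rfl | ⟨g, hg, hg0, hfac⟩
      · exact ⟨1, one_pos, Eventually.of_forall fun μ => by simp⟩
      · obtain ⟨c, hc, h2⟩ := exists_pos_eventually_le_norm
          ((hg.tendsto 0).comp (tendsto_const_div_atTop_nhds_zero_nat r)) hg0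
        refine ⟨c, hc, h2.mono fun μ hμ => ?_⟩
        rw [hfac, norm_mul, mul_comm]
        exact mul_le_mul_of_nonneg_left hμ (norm_nonneg _)
    refine tailDominated_of_small (θ := fun μ : ℕ => ‖r / (μ : ℂ)‖) hs hM hK.le hc (by omega) hn
      (fun μ => norm_nonneg _) ?_ (by simpa using hB0) ?_ ?_ (by simpa using hcm)
    · refine squeeze_zero (fun μ => by positivity) (fun μ => ?_)
        (by simpa using (tendsto_sq_div_of_isLittleO_sqrt hno).mul_const ‖r‖)
      rw [norm_div, Complex.norm_natCast, div_mul_eq_mul_div, mul_div_assoc']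
      gcongr
      exact_mod_cast Nat.le_self_pow two_ne_zero (n μ)
    · filter_upwards [hB] with μ hμ
      simpa using hμ 0
    · filter_upwards [hρ] with μ hμ i hi
      rw [PowerSeries.coeff_mk]
      have h2 := norm_coeff_differenceSeries_sub_le α β w hμ (i + p)
      rw [hzero i hi, sub_zero] at h2
      refine h2.trans (le_of_eq ?_)
      rw [hMdef, pow_add]
      ring

/-! ### The coefficients at the exceptional parameters -/

theorem genFactorial_neg_ne_zero {α : ℂ} (hα : α ≠ 0) (k : ℕ) :
    genFactorial (0 - α) k (-α) ≠ 0 := by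
  refine Finset.prod_ne_zero_iff.2 fun i _ => ?_
  have h : (0 - α) + i * (-α) = -(((i + 1 : ℕ) : ℂ) * α) := by push_cast; ring
  rw [h, neg_ne_zero]
  exact mul_ne_zero (by exact_mod_cast i.succ_ne_zero) hα

/-- For `β = α` all coefficients of order at least two vanish at `ρ = 0`. -/
theorem coeff_differenceSeries_self (α w ρ : ℂ) (k : ℕ) :
    PowerSeries.coeff (k + 1 + 1) (differenceSeries α α ρ w) =
      ρ * (1 / ((k + 1 + 1).factorial * α) * genFactorial (ρ - α) k (-α) *
        (w * (ρ + α) - (ρ - (k + 1) * α))) := by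
  rw [coeff_differenceSeries, genFactorial_succ' (ρ + α), genFactorial_succ _ (k + 1),
    show ρ + α + -α = ρ by ring, genFactorial_succ' ρ, ← sub_eq_add_neg]
  push_cast
  ring

/-- For `β = 2 α ≠ 0` and weight one all coefficients of order at least three vanish at `ρ = 0`;
the one of order three (`k = 0`) does so to second order, the others to first order. -/
theorem coeff_differenceSeries_two_mul (α ρ : ℂ) (k : ℕ) :
    PowerSeries.coeff (k + 1 + 2) (differenceSeries α (2 * α) ρ 1) =
      ρ * (1 / ((k + 1 + 2).factorial * (2 * α)) * genFactorial (ρ - α) k (-α) *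
        ((ρ + 2 * α) * (ρ + α) - (ρ - (k + 1) * α) * (ρ - (k + 2) * α))) := by
  rw [coeff_differenceSeries, genFactorial_succ' (ρ + 2 * α),
    show ρ + 2 * α + -α = ρ + α by ring, genFactorial_succ' (ρ + α),
    show ρ + α + -α = ρ by ring, genFactorial_succ _ (k + 1 + 1), genFactorial_succ _ (k + 1),
    genFactorial_succ' ρ, ← sub_eq_add_neg]
  push_cast
  ring

theorem tailDominated_coeffEps {α β r : ℂ} (hβ : β ≠ 0) (ε : ℝ) (m : ℕ) {n : ℕ → ℕ}
    (hn : Tendsto n atTop atTop)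
    (hno : (fun μ : ℕ => (n μ : ℝ)) =o[atTop] fun μ : ℕ => (μ : ℝ) ^ (1 / 2 : ℝ)) :
    TailDominated (fun μ : ℕ => PowerSeries.mk fun i => coeffEps α β (r / μ) ε (i + 1)) m n := by
  have hcoeff (ρ : ℂ) (i : ℕ) : coeffEps α β ρ ε (i + 1) =
      PowerSeries.coeff (i + 1) (differenceSeries α β ρ (Complex.exp ε)) := by
    rw [coeff_differenceSeries, coeffEps]
  simp only [hcoeff]
  refine tailDominated_differenceSeries hβ 1 m hn hno ?_ ?_
  · simp [coeff_differenceSeries, genFactorial, hβ, Complex.exp_ne_zero]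
  · rcases Nat.eq_zero_or_pos m with hm | hm
    · exact Or.inl hm
    refine Or.inr ?_
    by_cases hαβ : β = α
    · subst hαβ
      refine Or.inr ⟨fun i hi => ?_, Or.inr ?_⟩
      · obtain ⟨k, rfl⟩ : ∃ k, i = k + 1 := ⟨i - 1, by omega⟩
        rw [coeff_differenceSeries_self, zero_mul]
      · obtain ⟨k, rfl⟩ : ∃ k, m = k + 1 := ⟨m - 1, by omega⟩
        refine ⟨_, ?_, ?_, fun ρ => coeff_differenceSeries_self β _ ρ k⟩
        · unfold genFactorial
          fun_prop
        · refine mul_ne_zero (mul_ne_zero (one_div_ne_zero (mul_ne_zero ?_ hβ))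
            (genFactorial_neg_ne_zero hβ k)) ?_
          · exact_mod_cast Nat.factorial_ne_zero _
          · have h1 : Complex.exp ε * (0 + β) - (0 - ((k : ℂ) + 1) * β) =
                ((Real.exp ε + k + 1 : ℝ) : ℂ) * β := by
              push_cast
              ring
            rw [h1]
            refine mul_ne_zero (Complex.ofReal_ne_zero.2 ?_) hβ
            positivity
    · left
      have h1 : β - α ≠ 0 := sub_ne_zero.2 hαβ
      have h2 : β + -α ≠ 0 := by rwa [← sub_eq_add_neg]
      simp [coeff_differenceSeries, genFactorial, Finset.prod_range_succ, hβ, h2,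
        Complex.exp_ne_zero, Nat.factorial]

theorem tailDominated_coeffZero {α β r : ℂ} (hβ : β ≠ 0) (m : ℕ) {n : ℕ → ℕ}
    (hr : r = 0 ∨ (β ≠ α ∧ (m = 1 → β ≠ 2 * α))) (hn : Tendsto n atTop atTop)
    (hno : (fun μ : ℕ => (n μ : ℝ)) =o[atTop] fun μ : ℕ => (μ : ℝ) ^ (1 / 2 : ℝ)) :
    TailDominated (fun μ : ℕ => PowerSeries.mk fun i => coeffZero α β (r / μ) (i + 1)) m n := by
  have hcoeff (ρ : ℂ) (i : ℕ) : coeffZero α β ρ (i + 1) =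
      PowerSeries.coeff (i + 2) (differenceSeries α β ρ 1) := by
    rw [coeff_differenceSeries, coeffZero, one_mul]
  simp only [hcoeff]
  by_cases hαβ : β = α
  · subst hαβ
    have hr0 : r = 0 := hr.resolve_right fun h => h.1 rfl
    refine tailDominated_of_eq_zero (fun μ => ?_) m n
    ext i
    rw [PowerSeries.coeff_mk, hr0, zero_div, show i + 2 = i + 1 + 1 by rfl,
      coeff_differenceSeries_self, zero_mul, map_zero]
  have h1 : β + -α ≠ 0 := by rwa [← sub_eq_add_neg, sub_ne_zero]
  refine tailDominated_differenceSeries hβ 2 m hn hno ?_ ?_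
  · simp [coeff_differenceSeries, genFactorial, Finset.prod_range_succ, hβ, h1, Nat.factorial]
  · rcases Nat.eq_zero_or_pos m with hm | hm
    · exact Or.inl hm
    refine Or.inr ?_
    by_cases h2αβ : β = 2 * α
    · subst h2αβ
      have hα : α ≠ 0 := right_ne_zero_of_mul hβ
      refine Or.inr ⟨fun i hi => ?_, ?_⟩
      · obtain ⟨k, rfl⟩ : ∃ k, i = k + 1 := ⟨i - 1, by omega⟩
        rw [coeff_differenceSeries_two_mul, zero_mul]
      · refine hr.imp id fun h => ?_
        have hm1 : m ≠ 1 := fun h' => h.2 h' rfl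
        obtain ⟨k, rfl⟩ : ∃ k, m = k + 1 := ⟨m - 1, by omega⟩
        refine ⟨_, ?_, ?_, fun ρ => coeff_differenceSeries_two_mul α ρ k⟩
        · unfold genFactorial
          fun_prop
        · refine mul_ne_zero (mul_ne_zero (one_div_ne_zero (mul_ne_zero ?_ hβ))
            (genFactorial_neg_ne_zero hα k)) ?_
          · exact_mod_cast Nat.factorial_ne_zero _
          · have h3 : (0 + 2 * α) * (0 + α) - (0 - ((k : ℂ) + 1) * α) * (0 - ((k : ℂ) + 2) * α) =
                -(((k * (k + 3) : ℕ) : ℂ) * α ^ 2) := by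
              push_cast
              ring
            rw [h3, neg_ne_zero]
            refine mul_ne_zero (Nat.cast_ne_zero.2 ?_) (pow_ne_zero 2 hα)
            exact mul_ne_zero (by omega) (by omega)
    · left
      have h2 : β + -(2 * α) ≠ 0 := by rwa [← sub_eq_add_neg, sub_ne_zero]
      simp [coeff_differenceSeries, genFactorial, Finset.prod_range_succ, hβ, h1, h2,
        Nat.factorial]

theorem mainTheorem11 (α β r : ℂ) (hβ : β ≠ 0) :
    -- the case `ε ≠ 0`
    (∀ ε : ℝ, ε ≠ 0 →
      (∀ (ρ : ℂ) (j : ℕ),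
        coeffEps α β ρ ε j = genStirlingFun j 1 α β ρ ε / (j.factorial : ℂ)) ∧
      (∀ (m : ℕ) (n : ℕ → ℕ), Tendsto n atTop atTop →
        (fun μ : ℕ => (n μ : ℝ)) =o[atTop] (fun μ : ℕ => (μ : ℝ) ^ (1 / 2 : ℝ)) →
        (fun μ : ℕ => remainderEps α β r ε m (n μ) μ) =o[atTop]
          (fun μ : ℕ => leadFactor β ε (n μ) μ *
            expansionTerm (coeffEps α β (r / μ) ε) (n μ) μ m)) ∧
      (∀ m n : ℕ,
        (fun μ : ℕ => remainderEps α β r ε m n μ) =O[atTop]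
          (fun μ : ℕ => leadFactor β ε n μ * ((μ : ℂ) ^ (m + 1))⁻¹))) ∧
    -- the case `ε = 0`
    ((∀ (ρ : ℂ) (j : ℕ),
        coeffZero α β ρ j = genStirling (j + 1) 1 α β ρ / ((j + 1).factorial : ℂ)) ∧
      (∀ (m : ℕ) (n : ℕ → ℕ), (r = 0 ∨ (β ≠ α ∧ (m = 1 → β ≠ 2 * α))) →
        Tendsto n atTop atTop →
        (fun μ : ℕ => (n μ : ℝ)) =o[atTop] (fun μ : ℕ => (μ : ℝ) ^ (1 / 2 : ℝ)) →
        (fun μ : ℕ => remainderZero α β r m (n μ) μ) =o[atTop]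
          (fun μ : ℕ => expansionTerm (coeffZero α β (r / μ)) (n μ) μ m)) ∧
      (∀ m n : ℕ,
        (fun μ : ℕ => remainderZero α β r m n μ) =O[atTop]
          (fun μ : ℕ => ((μ : ℂ) ^ (m + 1))⁻¹))) := by
  refine ⟨fun ε _ => ⟨fun ρ j => coeffEps_eq_genStirlingFun α β ρ ε j, ?_, ?_⟩,
    fun ρ j => coeffZero_eq_genStirling α β ρ hβ j, ?_, ?_⟩
  · intro m n hn hno
    refine IsLittleO.congr' ((isBigO_refl (fun μ : ℕ => leadFactor β ε (n μ) μ) atTop).mul_isLittleO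
      (isLittleO_sum_expansionTerm ((Complex.exp ε - 1) / β) hn hno
        (tailDominated_coeffEps (α := α) (r := r) hβ ε m hn hno))) ?_ EventuallyEq.rfl
    filter_upwards [eventually_mul_two_le hn (tendsto_sq_div_of_isLittleO_sqrt hno),
      eventually_ne_atTop 0] with μ h1 h2
    exact (remainderEps_eq_sum α β r ε m (by omega) h2).symm
  · intro m n
    refine IsBigO.congr' ((isBigO_refl (fun μ : ℕ => leadFactor β ε n μ) atTop).mul
      (isBigO_sum_expansionTerm ((Complex.exp ε - 1) / β) m n
        (a := fun μ => coeffEps α β (r / μ) ε) (l := coeffEps α β 0 ε) fun i => ?_)) ?_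
      EventuallyEq.rfl
    · simpa only [coeff_differenceSeries, coeffEps] using
        tendsto_coeff_differenceSeries α β r (Complex.exp ε) i
    · filter_upwards [eventually_ge_atTop n, eventually_ne_atTop 0] with μ h1 h2
      exact (remainderEps_eq_sum α β r ε m h1 h2).symm
  · intro m n hr hn hno
    refine IsLittleO.congr' (isLittleO_sum_expansionTerm 1 hn hno
        (tailDominated_coeffZero (α := α) (r := r) hβ m hr hn hno)) ?_ EventuallyEq.rfl
    filter_upwards [eventually_mul_two_le hn (tendsto_sq_div_of_isLittleO_sqrt hno),
      eventually_ne_atTop 0] with μ h1 h2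
    rw [remainderZero_eq_sum α β r hβ m (by omega) h2]
    simp only [one_pow, one_mul]
  · intro m n
    refine IsBigO.congr' (isBigO_sum_expansionTerm 1 m n
        (a := fun μ => coeffZero α β (r / μ)) (l := coeffZero α β 0) fun i => ?_) ?_
      EventuallyEq.rfl
    · simpa only [coeff_differenceSeries, coeffZero, one_mul] using
        tendsto_coeff_differenceSeries α β r 1 (i + 1)
    · filter_upwards [eventually_ge_atTop n, eventually_ne_atTop 0] with μ h1 h2
      rw [remainderZero_eq_sum α β r hβ m h1 h2]
      simp only [one_pow, one_mul]
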